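/- Let $G=K_6\setminus K_4$ be the graph on six vertices obtained from the complete graph $K_6$ by deleting the edges of a complete graph on four of its vertices. Let $K_n\sqcup K_n$ be the disjoint union of two complete graphs on $n$ vertices. In the strong Ramsey game $\mathcal R(K_n\sqcup K_n,G)$ two players, P1 and P2, alternately take previously unclaimed edges of the board $K_n\sqcup K_n$, with P1 moving first. The first player whose edges contain a (not necessarily induced) copy of $G$ wins and the game stops; if all edges are taken and neither player has a copy, the game is a draw. Then there is a constant $C\ge 0$ such that for every $n$ and every non-negative integer $m<2n-C$, P1 has no strategy in $\mathcal R(K_n\sqcup K_n,G)$ which guarantees him, against every play of P2, a win within at most $m$ total moves (the moves of both players being counted). In other words, P1 has no strategy that guarantees a win in less than $2n-O(1)$ total moves as $n\to\infty$. -/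

import Mathlib

open SimpleGraph

namespace RamseyGame

universe u v

variable {V : Type u} {W : Type v}

/-- A history is the list of the edges taken so far, in chronological order. The players are
`0 : Fin 2` (first player, P1) and `1 : Fin 2` (second player, P2); they move alternately and P1
starts, so P1 takes the entries with even index and P2 those with odd index. -/
def claimed (p : Fin 2) (h : List (Sym2 V)) : Set (Sym2 V) :=
  {e | ∃ i : ℕ, i % 2 = (p : ℕ) ∧ h[i]? = some e}

/-- Player `p` has claimed all edges of a (not necessarily induced) copy of the target `H`. -/
def HasCopy (H : SimpleGraph W) (p : Fin 2) (h : List (Sym2 V)) : Prop :=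
  H ⊑ fromEdgeSet (claimed p h)

/-- `h` is a position of the strong Ramsey game on board `B` with target `H`: the edges taken are
distinct edges of the board, and no player had completed a copy of `H` before the last move (the
game stops as soon as a player completes a copy). -/
structure IsPosition (B : SimpleGraph V) (H : SimpleGraph W) (h : List (Sym2 V)) : Prop where
  mem_board : ∀ e ∈ h, e ∈ B.edgeSet
  nodup : h.Nodup
  undecided : ∀ t < h.length, ∀ p : Fin 2, ¬ HasCopy H p (h.take t)

/-- The game is over: a player has a copy of the target, or every edge of the board is taken. -/
def IsOver (B : SimpleGraph V) (H : SimpleGraph W) (h : List (Sym2 V)) : Prop :=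
  (∃ p : Fin 2, HasCopy H p h) ∨ ∀ e ∈ B.edgeSet, e ∈ h

/-- A strategy of P1: it prescribes a legal move in every position that is not over and in which it
is the turn of P1. (Values at other histories are irrelevant.) -/
structure Strategy₁ (B : SimpleGraph V) (H : SimpleGraph W) where
  move : List (Sym2 V) → Sym2 V
  legal : ∀ h : List (Sym2 V), IsPosition B H h → ¬ IsOver B H h → Even h.length →
    move h ∈ B.edgeSet ∧ move h ∉ h

/-- All moves of P1 in `h` are those prescribed by `σ`; the moves of P2 are arbitrary. -/
def Follows {B : SimpleGraph V} {H : SimpleGraph W} (σ : Strategy₁ B H)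
    (h : List (Sym2 V)) : Prop :=
  ∀ (i : ℕ) (hi : i < h.length), Even i → h[i] = σ.move (h.take i)

/-- `σ` guarantees P1 a win within at most `m` total moves (the moves of both players are counted):
however P2 plays, once the game is over or `m` moves have been made, P1 has a copy of `H`. As the
game stops with the first copy, P1 is then the first player to have completed one. -/
def GuaranteesWinWithin {B : SimpleGraph V} {H : SimpleGraph W} (σ : Strategy₁ B H)
    (m : ℕ) : Prop :=
  ∀ h : List (Sym2 V), IsPosition B H h → Follows σ h → h.length ≤ m →
    (IsOver B H h ∨ h.length = m) → HasCopy H 0 h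

/-- The board `K_n ⊔ K_n`. -/
def twoCliques (n : ℕ) : SimpleGraph (Fin n ⊕ Fin n) :=
  completeGraph (Fin n) ⊕g completeGraph (Fin n)

/-- The target graph `K_6 \ K_4`: the complete graph on six vertices with the edges of a complete
graph on four of them (the last four) removed. -/
def targetG : SimpleGraph (Fin 6) :=
  completeGraph (Fin 6) \ (completeGraph (Fin 4)).map (Fin.natAddEmb 2)

end RamseyGame

/-! A copy of `targetG` is a book with four pages: nine edges, formed by a spine `r s` and four
vertices joined to both of its ends. Suppose that P1 has a strategy that wins in time. P2 starts in
the clique that misses P1's first edge, which gains a tempo there, and builds a core: a three-page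
book with spine `a b`.

With a core, P2 can threaten for a long time (`endless_threats`). P2 takes `a x` for an untouched
vertex `x`, and P1 must take `b x`, since otherwise P2 takes it and completes a fourth page. The
forced reply hardly helps P1: `b x` is P1's only edge at `x`, so it creates a threat only if P1
already has a three-page book with `b` on its spine. A round costs two moves and one new vertex, so
the threats last for about `2n` moves.

When the core is completed, P1 is to move and may have threats to make first. If every unblocked
book has at most six edges of P1, no threat is available, and one of `a`, `b` can serve as the
vertex of the forced replies (`no_threats`). Otherwise all immediate threats are arranged to use one
spine `p q`. P2 answers each by taking the single missing edge, which kills either the spine or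
another edge of P1, so the same situation recurs (`Answerable`, `answer_threats`). As soon as P1
makes a move that is no threat, P2 starts the endless threats.

Building the core is a finite game. A `Diagram` abstracts the position, `corePlan` is P2's decision
tree, and `corePlan_valid` checks it by evaluation. `Plan.false_of_valid` transfers the tree to the
actual game, and `Depicts.false_of_safe` handles its leaves. -/

namespace RamseyGame

/-! ### Books, and copies of the target as four-page books. -/

section Books

variable {V : Type*} [DecidableEq V]

/-- The edges of the book with spine `r s` and set of pages `C`. -/
def book (r s : V) (C : Finset V) : Finset (Sym2 V) :=
  insert s(r, s) (C.image (fun c => s(r, c)) ∪ C.image (fun c => s(s, c)))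

theorem mem_book {r s : V} {C : Finset V} {e : Sym2 V} :
    e ∈ book r s C ↔ e = s(r, s) ∨ ∃ c ∈ C, e = s(r, c) ∨ e = s(s, c) := by
  simp only [book, Finset.mem_insert, Finset.mem_union, Finset.mem_image]
  grind

theorem book_comm (r s : V) (C : Finset V) : book r s C = book s r C := by
  ext e
  simp only [mem_book, Sym2.eq_swap (a := r) (b := s)]
  grind

theorem book_mono (r s : V) {C D : Finset V} (h : C ⊆ D) : book r s C ⊆ book r s D := by
  intro e he
  rw [mem_book] at he ⊢
  grind

theorem card_book {r s : V} {C : Finset V} (hrs : r ≠ s) (hr : r ∉ C) (hs : s ∉ C) :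
    (book r s C).card = 2 * C.card + 1 := by
  have h1 : (C.image (fun c => s(r, c))).card = C.card :=
    Finset.card_image_of_injective _ fun a b h => Sym2.congr_right.1 h
  have h2 : (C.image (fun c => s(s, c))).card = C.card :=
    Finset.card_image_of_injective _ fun a b h => Sym2.congr_right.1 h
  rw [book, Finset.card_insert_of_notMem, Finset.card_union_of_disjoint, h1, h2]
  · ring
  · rw [Finset.disjoint_left]
    simp only [Finset.mem_image, not_exists, not_and]
    rintro _ ⟨c, hc, rfl⟩ d hd h
    rw [Sym2.eq_iff] at h
    grind
  · simp only [Finset.mem_union, Finset.mem_image]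
    rintro (⟨c, hc, h⟩ | ⟨c, hc, h⟩) <;> rw [Sym2.eq_iff] at h <;> grind

/-- Counting page by page: a page contributes 2 only if P1 owns both of its edges, so bounding the
doubled pages bounds the whole book. -/
theorem card_inter_book_le (X : Finset (Sym2 V)) (r s : V) (C : Finset V) :
    (X ∩ book r s C).card ≤
      (X ∩ {s(r, s)}).card + ∑ c ∈ C, (X ∩ {s(r, c), s(s, c)}).card := by
  have h : X ∩ book r s C ⊆ (X ∩ {s(r, s)}) ∪ C.biUnion fun c => X ∩ {s(r, c), s(s, c)} := by
    intro e he
    simp only [Finset.mem_inter, mem_book, Finset.mem_union, Finset.mem_biUnion,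
      Finset.mem_insert, Finset.mem_singleton] at he ⊢
    grind
  exact (Finset.card_le_card h).trans
    ((Finset.card_union_le _ _).trans (Nat.add_le_add_left Finset.card_biUnion_le _))

/-- No edge of the book with spine `r s` and set of pages `C` is in `Z`. -/
def FreeBook (Z : Set (Sym2 V)) (r s : V) (C : Finset V) : Prop :=
  r ≠ s ∧ r ∉ C ∧ s ∉ C ∧ ∀ e ∈ book r s C, e ∉ Z

theorem FreeBook.symm {Z : Set (Sym2 V)} {r s : V} {C : Finset V} (h : FreeBook Z r s C) :
    FreeBook Z s r C :=
  ⟨h.1.symm, h.2.2.1, h.2.1, by rw [book_comm]; exact h.2.2.2⟩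

theorem FreeBook.spine {Z : Set (Sym2 V)} {r s : V} {C : Finset V} (h : FreeBook Z r s C) :
    s(r, s) ∉ Z := h.2.2.2 _ (mem_book.2 (Or.inl rfl))

theorem FreeBook.left {Z : Set (Sym2 V)} {r s c : V} {C : Finset V} (h : FreeBook Z r s C)
    (hc : c ∈ C) : s(r, c) ∉ Z := h.2.2.2 _ (mem_book.2 (Or.inr ⟨c, hc, Or.inl rfl⟩))

theorem FreeBook.right {Z : Set (Sym2 V)} {r s c : V} {C : Finset V} (h : FreeBook Z r s C)
    (hc : c ∈ C) : s(s, c) ∉ Z := h.2.2.2 _ (mem_book.2 (Or.inr ⟨c, hc, Or.inr rfl⟩))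

/-- No four-page book is contained in `X`. -/
def NoCopy (X : Finset (Sym2 V)) : Prop :=
  ∀ (r s : V) (C : Finset V), C.card = 4 → r ≠ s → r ∉ C → s ∉ C → ¬ book r s C ⊆ X

theorem targetG_adj (i j : Fin 6) : targetG.Adj i j ↔ i ≠ j ∧ (i.val < 2 ∨ j.val < 2) := by
  simp only [targetG, SimpleGraph.sdiff_adj, SimpleGraph.map_adj, completeGraph, top_adj]
  constructor
  · rintro ⟨hij, h⟩
    refine ⟨hij, ?_⟩
    by_contra! hc
    have lift : ∀ x : Fin 6, 2 ≤ x.val → ∃ y : Fin 4, Fin.natAddEmb 2 y = x :=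
      fun x hx => ⟨⟨x.val - 2, by omega⟩, Fin.ext (by change 2 + (x.val - 2) = x.val; omega)⟩
    obtain ⟨a, rfl⟩ := lift i hc.1
    obtain ⟨b, rfl⟩ := lift j hc.2
    exact h ⟨a, b, fun hab => hij (by rw [hab]), rfl, rfl⟩
  · rintro ⟨hij, h⟩
    refine ⟨hij, ?_⟩
    rintro ⟨a, b, -, rfl, rfl⟩
    have ha : (Fin.natAddEmb 2 a : Fin 6).val = 2 + a.val := rfl
    have hb : (Fin.natAddEmb 2 b : Fin 6).val = 2 + b.val := rfl
    omega

theorem targetG_isContained_iff (X : Finset (Sym2 V)) :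
    targetG ⊑ fromEdgeSet (X : Set (Sym2 V)) ↔ ¬ NoCopy X := by
  constructor
  · rintro ⟨f⟩ h
    have hinj : Function.Injective f := f.injective
    have hadj : ∀ i j : Fin 6, i ≠ j → (i.val < 2 ∨ j.val < 2) → s(f i, f j) ∈ X := by
      intro i j hij h2
      have := f.toHom.map_adj ((targetG_adj i j).2 ⟨hij, h2⟩)
      rw [fromEdgeSet_adj] at this
      exact_mod_cast this.1
    refine h (f 0) (f 1) (({2, 3, 4, 5} : Finset (Fin 6)).image f) ?_ ?_ ?_ ?_ ?_
    · rw [Finset.card_image_of_injective _ hinj]; rfl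
    · exact hinj.ne (by decide)
    · simp only [Finset.mem_image, not_exists, not_and]
      intro x hx hc
      have := hinj hc; subst this; revert hx; decide
    · simp only [Finset.mem_image, not_exists, not_and]
      intro x hx hc
      have := hinj hc; subst this; revert hx; decide
    · intro e he
      rw [mem_book] at he
      simp only [Finset.mem_image] at he
      rcases he with rfl | ⟨_, ⟨x, hx, rfl⟩, rfl | rfl⟩
      · exact hadj 0 1 (by decide) (by decide)
      · exact hadj 0 x (by rintro rfl; revert hx; decide) (Or.inl (by decide))
      · exact hadj 1 x (by rintro rfl; revert hx; decide) (Or.inl (by decide))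
  · intro h
    simp only [NoCopy, not_forall, not_not] at h
    obtain ⟨r, s, C, hC, hrs, hr, hs, hsub⟩ := h
    obtain ⟨c1, c2, c3, c4, h12, h13, h14, h23, h24, h34, rfl⟩ := Finset.card_eq_four.1 hC
    have hin : ∀ e, e ∈ book r s {c1, c2, c3, c4} → e ∈ X := fun e he => hsub he
    simp only [mem_book, Finset.mem_insert, Finset.mem_singleton] at hin hr hs
    let g : Fin 6 → V := ![r, s, c1, c2, c3, c4]
    have ginj : Function.Injective g := by
      intro i j hij
      fin_cases i <;> fin_cases j <;> simp [g] at hij ⊢ <;> grind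
    refine ⟨⟨⟨g, ?_⟩, ginj⟩⟩
    intro i j hij
    rw [targetG_adj] at hij
    rw [fromEdgeSet_adj]
    refine ⟨?_, ginj.ne hij.1⟩
    have key : ∀ i j : Fin 6, i ≠ j → i.val < 2 → s(g i, g j) ∈ X := by
      intro i j hij hi
      apply hin
      fin_cases i <;> fin_cases j <;> simp [g] at hi hij ⊢
    rcases hij.2 with h | h
    · exact_mod_cast key i j hij.1 h
    · rw [Sym2.eq_swap]; exact_mod_cast key j i hij.1.symm h

end Books

/-! ### Positions reachable against a fixed strategy of P1. -/

section Reach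

variable {V : Type*} {B : SimpleGraph V}

theorem claimed_append (p : Fin 2) (h : List (Sym2 V)) (e : Sym2 V) :
    claimed p (h ++ [e]) = if h.length % 2 = (p : ℕ) then insert e (claimed p h)
      else claimed p h := by
  ext x
  have key : x ∈ claimed p (h ++ [e]) ↔ x ∈ claimed p h ∨ (h.length % 2 = (p : ℕ) ∧ x = e) := by
    simp only [claimed, Set.mem_ofPred_eq]
    constructor
    · rintro ⟨i, hi, hx⟩
      rcases lt_trichotomy i h.length with hl | rfl | hl
      · rw [List.getElem?_append_left hl] at hx; exact Or.inl ⟨i, hi, hx⟩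
      · simp at hx; exact Or.inr ⟨hi, hx.symm⟩
      · rw [List.getElem?_eq_none (by simp; omega)] at hx; simp at hx
    · rintro (⟨i, hi, hx⟩ | ⟨hi, rfl⟩)
      · refine ⟨i, hi, ?_⟩
        have hl : i < h.length := by
          by_contra hc
          rw [List.getElem?_eq_none (by omega)] at hx; simp at hx
        rw [List.getElem?_append_left hl, hx]
      · exact ⟨h.length, hi, by simp⟩
  rw [key]
  split_ifs with hp
  · rw [Set.mem_insert_iff]; tauto
  · tauto

theorem mem_iff_claimed (h : List (Sym2 V)) (e : Sym2 V) :
    e ∈ h ↔ e ∈ claimed 0 h ∨ e ∈ claimed 1 h := by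
  simp only [claimed, Set.mem_ofPred_eq, List.mem_iff_getElem?]
  constructor
  · rintro ⟨i, hi⟩
    rcases Nat.mod_two_eq_zero_or_one i with h0 | h0
    · exact Or.inl ⟨i, by simpa using h0, hi⟩
    · exact Or.inr ⟨i, by simpa using h0, hi⟩
  · rintro (⟨i, -, hi⟩ | ⟨i, -, hi⟩) <;> exact ⟨i, hi⟩

/-- Some position with `ℓ ≤ m` moves that is consistent with `σ` has claimed sets `X` (P1) and
`Y` (P2). -/
def Reach (σ : Strategy₁ B targetG) (m : ℕ) (X Y : Finset (Sym2 V)) (ℓ : ℕ) : Prop :=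
  ∃ h : List (Sym2 V), IsPosition B targetG h ∧ Follows σ h ∧ h.length = ℓ ∧ ℓ ≤ m ∧
    claimed 0 h = ↑X ∧ claimed 1 h = ↑Y

variable {σ : Strategy₁ B targetG} {m ℓ : ℕ} {X Y : Finset (Sym2 V)}

theorem reach_nil : Reach σ m ∅ ∅ 0 := by
  refine ⟨[], ⟨by simp, by simp, by simp⟩, by intro i hi; simp at hi, rfl, Nat.zero_le _, ?_, ?_⟩ <;>
    simp [claimed]

theorem Reach.left_board (r : Reach σ m X Y ℓ) : ∀ e ∈ X, e ∈ B.edgeSet := by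
  obtain ⟨h, hp, -, -, -, hX, hY⟩ := r
  intro e he
  exact hp.mem_board e ((mem_iff_claimed h e).2 (Or.inl (by rw [hX]; exact_mod_cast he)))

theorem Reach.right_board (r : Reach σ m X Y ℓ) : ∀ e ∈ Y, e ∈ B.edgeSet := by
  obtain ⟨h, hp, -, -, -, hX, hY⟩ := r
  intro e he
  exact hp.mem_board e ((mem_iff_claimed h e).2 (Or.inr (by rw [hY]; exact_mod_cast he)))

theorem Reach.disjoint (r : Reach σ m X Y ℓ) : ∀ e ∈ X, e ∉ Y := by
  obtain ⟨h, hp, -, -, -, hX, hY⟩ := r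
  intro e he he'
  have h0 : e ∈ claimed 0 h := by rw [hX]; exact_mod_cast he
  have h1 : e ∈ claimed 1 h := by rw [hY]; exact_mod_cast he'
  obtain ⟨i, hi, hei⟩ := h0
  obtain ⟨j, hj, hej⟩ := h1
  have hil : i < h.length := by
    by_contra hc; rw [List.getElem?_eq_none (by omega)] at hei; simp at hei
  have := (List.getElem?_inj hil hp.nodup).1 (hei.trans hej.symm)
  subst this
  simp at hi hj
  omega

theorem extend_position {h : List (Sym2 V)} (hp : IsPosition B targetG h)
    (hover : ¬ IsOver B targetG h) {e : Sym2 V} (he : e ∈ B.edgeSet) (heh : e ∉ h) :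
    IsPosition B targetG (h ++ [e]) := by
  refine ⟨?_, ?_, ?_⟩
  · intro x hx
    rw [List.mem_append, List.mem_singleton] at hx
    rcases hx with hx | rfl
    · exact hp.mem_board x hx
    · exact he
  · rw [List.nodup_append]
    refine ⟨hp.nodup, by simp, ?_⟩
    intro a ha b hb
    rw [List.mem_singleton] at hb
    subst hb
    rintro rfl
    exact heh ha
  · intro t ht p
    rw [List.length_append, List.length_singleton] at ht
    rw [List.take_append_of_le_length (by omega)]
    rcases Nat.lt_or_ge t h.length with h' | h'
    · exact hp.undecided t h' p
    · rw [List.take_of_length_le h']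
      exact fun hc => hover (Or.inl ⟨p, hc⟩)

variable [DecidableEq V]

theorem hasCopy_iff {p : Fin 2} {h : List (Sym2 V)} (hX : claimed p h = ↑X) :
    HasCopy targetG p h ↔ ¬ NoCopy X := by
  rw [HasCopy, hX, targetG_isContained_iff]

/-- Under the guarantee, a finished game or an exhausted move budget comes with a copy of P1. So
while P1 has none, play continues; conversely, a copy of P2 or `ℓ = m` at such a moment is the
contradiction that every later argument aims at. -/
theorem Reach.running (r : Reach σ m X Y ℓ) (G : GuaranteesWinWithin σ m) (hno : NoCopy X) :
    ℓ < m ∧ NoCopy Y ∧ ∃ h : List (Sym2 V), IsPosition B targetG h ∧ Follows σ h ∧ h.length = ℓ ∧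
      claimed 0 h = ↑X ∧ claimed 1 h = ↑Y ∧ ¬ IsOver B targetG h := by
  obtain ⟨h, hp, hf, hl, hm, hX, hY⟩ := r
  have h0 : ¬ HasCopy targetG 0 h := by rw [hasCopy_iff hX]; exact not_not.2 hno
  have h1 : ¬ (IsOver B targetG h ∨ h.length = m) := fun hc => h0 (G h hp hf (by omega) hc)
  push Not at h1
  refine ⟨by omega, ?_, h, hp, hf, hl, hX, hY, h1.1⟩
  by_contra hc
  exact h1.1 (Or.inl ⟨1, (hasCopy_iff hY).2 hc⟩)

theorem Reach.step_one (r : Reach σ m X Y ℓ) (G : GuaranteesWinWithin σ m) (hno : NoCopy X) (hev : Even ℓ) :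
    ∃ e ∈ B.edgeSet, e ∉ X ∧ e ∉ Y ∧ Reach σ m (insert e X) Y (ℓ + 1) := by
  obtain ⟨hlt, -, h, hp, hf, hl, hX, hY, hover⟩ := r.running G hno
  obtain ⟨hb, hnm⟩ := σ.legal h hp hover (hl ▸ hev)
  have hnm' := hnm
  rw [mem_iff_claimed, hX, hY] at hnm'
  push Not at hnm'
  refine ⟨σ.move h, hb, by exact_mod_cast hnm'.1, by exact_mod_cast hnm'.2, h ++ [σ.move h],
    extend_position hp hover hb hnm, ?_, by simp [hl], hlt, ?_, ?_⟩
  · intro i hi hie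
    rw [List.length_append, List.length_singleton] at hi
    rcases Nat.lt_or_ge i h.length with h' | h'
    · rw [List.getElem_append_left h', List.take_append_of_le_length h'.le]
      exact hf i h' hie
    · have : i = h.length := by omega
      subst this
      simp
  · rw [claimed_append, if_pos (by simp; rw [hl]; exact Nat.even_iff.1 hev), hX]; simp
  · rw [claimed_append, if_neg (by simp; rw [hl]; have := Nat.even_iff.1 hev; omega), hY]

theorem Reach.step_two (r : Reach σ m X Y ℓ) (G : GuaranteesWinWithin σ m) (hno : NoCopy X) (hodd : Odd ℓ) {e : Sym2 V}
    (he : e ∈ B.edgeSet) (heX : e ∉ X) (heY : e ∉ Y) : Reach σ m X (insert e Y) (ℓ + 1) := by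
  obtain ⟨hlt, -, h, hp, hf, hl, hX, hY, hover⟩ := r.running G hno
  have hnm : e ∉ h := by
    rw [mem_iff_claimed, hX, hY]; push Not; exact ⟨by exact_mod_cast heX, by exact_mod_cast heY⟩
  refine ⟨h ++ [e], extend_position hp hover he hnm, ?_, by simp [hl], hlt, ?_, ?_⟩
  · intro i hi hie
    rw [List.length_append, List.length_singleton] at hi
    rcases Nat.lt_or_ge i h.length with h' | h'
    · rw [List.getElem_append_left h', List.take_append_of_le_length h'.le]
      exact hf i h' hie
    · have : i = h.length := by omega
      subst this
      rw [hl] at hie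
      exact absurd hie (Nat.not_even_iff_odd.2 hodd)
  · rw [claimed_append, if_neg (by simp; rw [hl]; have := Nat.odd_iff.1 hodd; omega), hX]
  · rw [claimed_append, if_pos (by simp; rw [hl]; exact Nat.odd_iff.1 hodd), hY]; simp

end Reach

end RamseyGame
namespace RamseyGame

/-! ### Endless threats from a core. -/

section Threats

variable {V : Type*}

/-- The pairs that P1 can no longer claim when P2 has claimed `Y`. -/
def Taken (B : SimpleGraph V) (Y : Finset (Sym2 V)) : Set (Sym2 V) :=
  {e | e ∉ B.edgeSet ∨ e ∈ Y}

theorem notMem_taken {B : SimpleGraph V} {Y : Finset (Sym2 V)} {e : Sym2 V} :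
    e ∉ Taken B Y ↔ e ∈ B.edgeSet ∧ e ∉ Y := by
  simp [Taken]

theorem taken_mono {B : SimpleGraph V} {Y Y' : Finset (Sym2 V)} (h : Y ⊆ Y') : Taken B Y ⊆ Taken B Y' := by
  rintro e (he | he)
  · exact Or.inl he
  · exact Or.inr (h he)

/-- `B` consists of two cliques, distinguished by `side`, with at least `n` vertices each. -/
structure Arena (B : SimpleGraph V) (side : V → Bool) (n : ℕ) : Prop where
  adj : ∀ x y, B.Adj x y ↔ x ≠ y ∧ side x = side y
  fresh : ∀ (b : Bool) (T : Finset V), T.card < n → ∃ x ∉ T, side x = b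

variable [DecidableEq V] {B : SimpleGraph V} {σ : Strategy₁ B targetG} {m ℓ n : ℕ}
  {X Y : Finset (Sym2 V)} {side : V → Bool}

/-- P1 has at most `k` edges of every four-page book that P2 has not blocked. -/
def AtMost (B : SimpleGraph V) (k : ℕ) (X Y : Finset (Sym2 V)) : Prop :=
  ∀ (r s : V) (D : Finset V), D.card = 4 → FreeBook (Taken B Y) r s D →
    (X ∩ book r s D).card ≤ k

theorem AtMost.insert_left {k : ℕ} (h : AtMost B k X Y) (e : Sym2 V) :
    AtMost B (k + 1) (insert e X) Y := by
  intro r s D hD hf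
  have h1 : insert e X ∩ book r s D ⊆ insert e (X ∩ book r s D) := by
    intro x hx
    simp only [Finset.mem_inter, Finset.mem_insert] at hx ⊢
    tauto
  exact (Finset.card_le_card h1).trans
    ((Finset.card_insert_le _ _).trans (Nat.succ_le_succ (h r s D hD hf)))

theorem FreeBook.mono {Z W : Set (Sym2 V)} {r s : V} {D : Finset V} (h : FreeBook W r s D)
    (hZ : Z ⊆ W) : FreeBook Z r s D :=
  ⟨h.1, h.2.1, h.2.2.1, fun e he hc => h.2.2.2 e he (hZ hc)⟩

theorem AtMost.mono_right {k : ℕ} {Y' : Finset (Sym2 V)} (h : AtMost B k X Y) (hY : Y ⊆ Y') :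
    AtMost B k X Y' :=
  fun r s D hD hf => h r s D hD (hf.mono (taken_mono hY))

theorem AtMost.mono {k k' : ℕ} (h : AtMost B k X Y) (hk : k ≤ k') : AtMost B k' X Y :=
  fun r s D hD hf => (h r s D hD hf).trans hk

/-- A copy owned by P1 is automatically unblocked and has nine edges. Hence `AtMost 8` means that P1
has not won, and `AtMost 7` that P1 cannot win with the next move. -/
theorem AtMost.noCopy (h : AtMost B 8 X Y) (r : Reach σ m X Y ℓ) : NoCopy X := by
  intro u v D hD huv hu hv hsub
  have hf : FreeBook (Taken B Y) u v D :=
    ⟨huv, hu, hv, fun e he => notMem_taken.2 ⟨r.left_board e (hsub he), r.disjoint e (hsub he)⟩⟩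
  have := h u v D hD hf
  rw [Finset.inter_eq_right.2 hsub, card_book huv hu hv, hD] at this
  omega

/-- `T` contains all endpoints of claimed edges. -/
def Touched (T : Finset V) (X Y : Finset (Sym2 V)) : Prop :=
  ∀ e, e ∈ X ∨ e ∈ Y → ∀ v ∈ e, v ∈ T

/-- The invariant is that P1 has no threat and no three-page book with `b` on its spine. It survives
a round because P1's only edge at the new vertex `x` is `b x`. A round adds one touched vertex and
two moves, so `2 * T.card ≤ ℓ + c₀` persists. -/
theorem endless_threats (A : Arena B side n) (G : GuaranteesWinWithin σ m) {c₀ : ℕ}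
    (hm : m + c₀ ≤ 2 * n) {a b : V} {C : Finset V} (hC : C.card = 3) (hab : a ≠ b) (haC : a ∉ C)
    (hbC : b ∉ C) :
    ∀ (k : ℕ) (X Y : Finset (Sym2 V)) (T : Finset V) (ℓ : ℕ), m ≤ ℓ + k → Odd ℓ →
      Reach σ m X Y ℓ → book a b C ⊆ Y → AtMost B 7 X Y →
      (∀ (s : V) (D : Finset V), D.card = 3 → b ≠ s → b ∉ D → s ∉ D → ¬ book b s D ⊆ X) →
      Touched T X Y → 2 * T.card ≤ ℓ + c₀ → False := by
  intro k
  induction k using Nat.strong_induction_on with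
  | _ k ih =>
  intro X Y T ℓ hk hodd hr hY h7 hb hT hcard
  have hno : NoCopy X := (h7.mono (by norm_num)).noCopy hr
  obtain ⟨hlt, -, -⟩ := hr.running G hno
  -- Here `2 * T.card ≤ ℓ + c₀ < m + c₀ ≤ 2 * n`, so an untouched vertex remains.
  obtain ⟨x, hxT, hxs⟩ := A.fresh (side a) T (by omega)
  have habY : s(a, b) ∈ Y := hY (mem_book.2 (Or.inl rfl))
  have hsab : side a = side b := ((A.adj a b).1 (hr.right_board _ habY)).2
  have haT : a ∈ T := hT _ (Or.inr habY) a (by simp)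
  have hbT : b ∈ T := hT _ (Or.inr habY) b (by simp)
  have hCT : ∀ c ∈ C, c ∈ T := fun c hc =>
    hT s(a, c) (Or.inr (hY (mem_book.2 (Or.inr ⟨c, hc, Or.inl rfl⟩)))) c (by simp)
  have hax : a ≠ x := by rintro rfl; exact hxT haT
  have hbx : b ≠ x := by rintro rfl; exact hxT hbT
  have hnew : ∀ v, s(v, x) ∉ X ∧ s(v, x) ∉ Y := fun v =>
    ⟨fun h => hxT (hT _ (Or.inl h) x (by simp)), fun h => hxT (hT _ (Or.inr h) x (by simp))⟩
  have haxB : s(a, x) ∈ B.edgeSet := (A.adj a x).2 ⟨hax, hxs.symm⟩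
  have hbxB : s(b, x) ∈ B.edgeSet := (A.adj b x).2 ⟨hbx, by rw [← hsab, hxs]⟩
  have hr1 := hr.step_two G hno hodd haxB (hnew a).1 (hnew a).2
  obtain ⟨e, heB, heX, heY, hr2⟩ := hr1.step_one G hno hodd.add_one
  have h7' : AtMost B 7 X (insert s(a, x) Y) := h7.mono_right (Finset.subset_insert _ _)
  have hno2 : NoCopy (insert e X) := (h7'.insert_left e).noCopy hr2
  have hodd2 : Odd (ℓ + 1 + 1) := by
    rw [Nat.odd_iff] at hodd ⊢; omega
  by_cases hebx : e = s(b, x)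
  · subst hebx
    have hlt2 := (hr2.running G hno2).1
    refine ih (k - 1) (by omega) _ _ (insert x T) _ (by omega) hodd2 hr2
      (hY.trans (Finset.subset_insert _ _)) ?_ ?_ ?_ ?_
    -- A book with eight edges of P1 after the reply must contain `b x` and lack at most one edge.
    -- Every other edge of it at `x` is lacking, so there is at most one of those.
    · intro r s D hD hf
      by_contra hcon
      have h7r := h7' r s D hD hf
      have hmem : s(b, x) ∈ book r s D := by
        by_contra hn
        rw [Finset.insert_inter_of_notMem hn] at hcon
        exact hcon h7r
      rw [Finset.insert_inter_of_mem hmem, Finset.card_insert_of_notMem (by simp [heX])] at hcon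
      have hcard9 := card_book hf.1 hf.2.1 hf.2.2.1
      rw [hD] at hcard9
      have hmiss : (book r s D \ insert s(b, x) X).card ≤ 1 := by
        have := Finset.card_sdiff_add_card_inter (book r s D) (insert s(b, x) X)
        rw [Finset.inter_comm, Finset.insert_inter_of_mem hmem,
          Finset.card_insert_of_notMem (by simp [heX])] at this
        omega
      have huniq : ∀ v w, s(v, x) ∈ book r s D → s(w, x) ∈ book r s D → v ≠ b → w ≠ b →
          v = w := by
        intro v w hv hw hvb hwb
        have key : ∀ u, s(u, x) ∈ book r s D → u ≠ b →
            s(u, x) ∈ book r s D \ insert s(b, x) X := by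
          intro u hu hub
          rw [Finset.mem_sdiff, Finset.mem_insert]
          refine ⟨hu, ?_⟩
          rintro (h | h)
          · exact hub (Sym2.congr_left.1 h)
          · exact (hnew u).1 h
        exact Sym2.congr_left.1 (Finset.card_le_one.1 hmiss _ (key v hv hvb) _ (key w hw hwb))
      -- If `x` were on the spine, at least three pages other than `b` would each give a lacking
      -- edge at `x`.
      have spine_case : ∀ r s, FreeBook (Taken B (insert s(a, x) Y)) r s D →
          (∀ v w, s(v, x) ∈ book r s D → s(w, x) ∈ book r s D → v ≠ b → w ≠ b → v = w) →
          x ≠ r := by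
        rintro r s hf hu rfl
        have hD2 : 1 < (D.erase b).card := by
          have := Finset.pred_card_le_card_erase (s := D) (a := b); omega
        obtain ⟨c, hc, d, hd, hcd⟩ := Finset.one_lt_card.1 hD2
        rw [Finset.mem_erase] at hc hd
        refine hcd (hu c d ?_ ?_ hc.1 hd.1) <;> rw [mem_book]
        · exact Or.inr ⟨c, hc.2, Or.inl Sym2.eq_swap⟩
        · exact Or.inr ⟨d, hd.2, Or.inl Sym2.eq_swap⟩
      have hxr : x ≠ r := spine_case r s hf huniq
      have hxs' : x ≠ s := spine_case s r hf.symm (by rw [book_comm]; exact huniq)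
      -- If `x` is a page of the spine `b s`, the lacking edge is `s x`. Removing that page leaves a
      -- three-page book of P1 at `b`, which the invariant forbids.
      have page_case : ∀ s, FreeBook (Taken B (insert s(a, x) Y)) b s D → x ≠ s → x ∈ D →
          (book b s D \ insert s(b, x) X).card ≤ 1 → False := by
        intro s hf hxs hxD hmiss
        have hmem : s(s, x) ∈ book b s D \ insert s(b, x) X := by
          rw [Finset.mem_sdiff, mem_book, Finset.mem_insert]
          refine ⟨Or.inr ⟨x, hxD, Or.inr rfl⟩, ?_⟩
          rintro (h | h)
          · exact hf.1 (Sym2.congr_left.1 h).symm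
          · exact (hnew s).1 h
        refine hb s (D.erase x) (by rw [Finset.card_erase_of_mem hxD, hD]) hf.1
          (fun h => hf.2.1 (Finset.mem_of_mem_erase h))
          (fun h => hf.2.2.1 (Finset.mem_of_mem_erase h)) ?_
        intro e he
        by_contra heX
        have hxe : x ∉ e := by
          rw [mem_book] at he
          simp only [Finset.mem_erase] at he
          rcases he with rfl | ⟨c, hc, rfl | rfl⟩
          · simp [hbx.symm, hxs]
          · simp [hbx.symm, Ne.symm hc.1]
          · simp [hxs, Ne.symm hc.1]
        have : e ∈ book b s D \ insert s(b, x) X := by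
          rw [Finset.mem_sdiff, Finset.mem_insert]
          refine ⟨book_mono _ _ (Finset.erase_subset _ _) he, ?_⟩
          rintro (h | h)
          · exact hxe (h ▸ by simp)
          · exact heX h
        have := Finset.card_le_one.1 hmiss _ this _ hmem
        exact hxe (this ▸ by simp)
      rw [mem_book] at hmem
      rcases hmem with h | ⟨c, hc, h | h⟩ <;> rw [Sym2.eq_iff] at h
      · rcases h with ⟨-, h⟩ | ⟨-, h⟩
        · exact hxs' h
        · exact hxr h
      · rcases h with ⟨h, h'⟩ | ⟨-, h⟩
        · subst h h'; exact page_case s hf hxs' hc hmiss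
        · exact hxr h
      · rcases h with ⟨h, h'⟩ | ⟨-, h⟩
        · subst h h'
          exact page_case r hf.symm hxr hc (by rw [book_comm]; exact hmiss)
        · exact hxs' h
    · intro s D hD hbs hbD hsD hsub
      refine hb s D hD hbs hbD hsD ?_
      have hin : ∀ v, s(v, x) ∈ book b s D → v = b := by
        intro v hv
        rcases Finset.mem_insert.1 (hsub hv) with h | h
        · exact Sym2.congr_left.1 h
        · exact absurd h (hnew v).1
      have hxs' : x ≠ s := by
        rintro rfl
        obtain ⟨c, hc⟩ : D.Nonempty := by rw [← Finset.card_pos]; omega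
        have := hin c (mem_book.2 (Or.inr ⟨c, hc, Or.inr Sym2.eq_swap⟩))
        exact hbD (this ▸ hc)
      have hxD : x ∉ D := fun hx =>
        hbs (hin s (mem_book.2 (Or.inr ⟨x, hx, Or.inr rfl⟩))).symm
      intro e he
      rcases Finset.mem_insert.1 (hsub he) with h | h
      · subst h
        rw [mem_book] at he
        rcases he with h | ⟨c, hc, h | h⟩ <;> rw [Sym2.eq_iff] at h <;> grind
      · exact h
    · intro e he v hv
      rw [Finset.mem_insert, Finset.mem_insert] at he
      rw [Finset.mem_insert]
      rcases he with (rfl | he) | (rfl | he)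
      · rcases Sym2.mem_iff.1 hv with rfl | rfl
        · exact Or.inr hbT
        · exact Or.inl rfl
      · exact Or.inr (hT e (Or.inl he) v hv)
      · rcases Sym2.mem_iff.1 hv with rfl | rfl
        · exact Or.inr haT
        · exact Or.inl rfl
      · exact Or.inr (hT e (Or.inr he) v hv)
    · have := Finset.card_insert_le x T
      omega
  -- P1 did not answer the threat, so P2 takes `b x` and completes a four-page book.
  · have hbxY : s(b, x) ∉ insert s(a, x) Y := by
      rw [Finset.mem_insert]
      rintro (h | h)
      · exact hab (Sym2.congr_left.1 h).symm
      · exact (hnew b).2 h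
    have hbxX : s(b, x) ∉ insert e X := by
      rw [Finset.mem_insert]
      rintro (h | h)
      · exact hebx h.symm
      · exact (hnew b).1 h
    have hr3 := hr2.step_two G hno2 hodd2 hbxB hbxX hbxY
    have hxC : x ∉ C := fun h => hxT (hCT x h)
    refine (hr3.running G hno2).2.1 a b (insert x C) (by rw [Finset.card_insert_of_notMem hxC, hC])
      hab (by simp [hax, haC]) (by simp [hbx, hbC]) ?_
    intro e he
    rw [mem_book] at he
    simp only [Finset.mem_insert] at he ⊢
    rcases he with rfl | ⟨c, rfl | hc, h⟩
    · exact Or.inr (Or.inr habY)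
    · tauto
    · exact Or.inr (Or.inr (hY (mem_book.2 (Or.inr ⟨c, hc, h⟩))))

end Threats

end RamseyGame
namespace RamseyGame

/-! ### Positions in which all immediate threats of P1 share one spine. -/

section Forcing

variable {V : Type*} [DecidableEq V] {B : SimpleGraph V} {σ : Strategy₁ B targetG} {m ℓ n : ℕ}
  {X Y : Finset (Sym2 V)} {side : V → Bool}

open scoped Classical in
/-- The edges of `X` that can be part of a book with spine `p q` avoiding `Z`. -/
noncomputable def compat (Z : Set (Sym2 V)) (X : Finset (Sym2 V)) (p q : V) : Finset (Sym2 V) :=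
  X.filter fun e => e = s(p, q) ∨ ∃ x, x ≠ p ∧ x ≠ q ∧ (e = s(p, x) ∨ e = s(q, x)) ∧
    s(p, x) ∉ Z ∧ s(q, x) ∉ Z

theorem mem_compat {Z : Set (Sym2 V)} {p q : V} {e : Sym2 V} :
    e ∈ compat Z X p q ↔ e ∈ X ∧ (e = s(p, q) ∨ ∃ x, x ≠ p ∧ x ≠ q ∧
      (e = s(p, x) ∨ e = s(q, x)) ∧ s(p, x) ∉ Z ∧ s(q, x) ∉ Z) := by
  classical
  rw [compat, Finset.mem_filter]

theorem inter_book_subset_compat {Z : Set (Sym2 V)} {p q : V} {D : Finset V}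
    (hf : FreeBook Z p q D) : X ∩ book p q D ⊆ compat Z X p q := by
  intro e he
  rw [Finset.mem_inter, mem_book] at he
  refine mem_compat.2 ⟨he.1, he.2.imp id ?_⟩
  rintro ⟨c, hc, h⟩
  exact ⟨c, fun h' => hf.2.1 (h' ▸ hc), fun h' => hf.2.2.1 (h' ▸ hc), h, hf.left hc, hf.right hc⟩

/-- The edges of `X` all of whose endpoints are on the side `b`. -/
def onSide (side : V → Bool) (b : Bool) (X : Finset (Sym2 V)) : Finset (Sym2 V) :=
  X.filter fun e => ∀ v ∈ e.toFinset, side v = b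

theorem mem_onSide {b : Bool} {e : Sym2 V} :
    e ∈ onSide side b X ↔ e ∈ X ∧ ∀ v ∈ e, side v = b := by
  simp [onSide]

/-- Every threat that P1 can make at once in this position is in a book with spine `p q`, and P2
can answer it: all edges of P1 on the side of `p` meet the spine, with at most one exception,
which has an endpoint that cannot be joined to both `p` and `q`. -/
structure Answerable (B : SimpleGraph V) (side : V → Bool) (p q : V) (T X Y : Finset (Sym2 V)) :
    Prop where
  ne : p ≠ q
  side_eq : side p = side q
  far : (onSide side (!side p) X).card ≤ 5
  cover : ∀ e ∈ X, p ∈ e ∨ q ∈ e ∨ e ∈ onSide side (!side p) X ∨ e ∈ T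
  stray_unique : T.card ≤ 1
  stray : ∀ t ∈ T, ∃ c d, t = s(c, d) ∧ c ≠ p ∧ c ≠ q ∧ d ≠ p ∧ d ≠ q ∧ s(p, d) ∉ X ∧ s(q, d) ∉ X ∧
    (s(p, d) ∈ Taken B Y ∨ s(q, d) ∈ Taken B Y)
  spine : s(p, q) ∈ Taken B Y ∨ (compat (Taken B Y) X p q).card ≤ 7

variable {p q : V} {T : Finset (Sym2 V)}

theorem Answerable.symm (h : Answerable B side p q T X Y) : Answerable B side q p T X Y where
  ne := h.ne.symm
  side_eq := h.side_eq.symm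
  far := h.side_eq ▸ h.far
  cover := fun e he => by have := h.cover e he; rw [h.side_eq] at this; tauto
  stray_unique := h.stray_unique
  stray := by
    intro t ht
    obtain ⟨c, d, h1, h2, h3, h4, h5, h6, h7, h8⟩ := h.stray t ht
    exact ⟨c, d, h1, h3, h2, h5, h4, h7, h6, h8.symm⟩
  spine := by
    have : compat (Taken B Y) X q p = compat (Taken B Y) X p q := by
      ext e
      simp only [mem_compat, Sym2.eq_swap (a := q) (b := p)]
      grind
    rw [this, Sym2.eq_swap]
    exact h.spine

theorem card_inter_pair_le_one {a b : Sym2 V} (h : a ∈ X → b ∈ X → False) :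
    (X ∩ {a, b}).card ≤ 1 := by
  rw [Finset.card_le_one]
  intro x hx y hy
  simp only [Finset.mem_inter, Finset.mem_insert, Finset.mem_singleton] at hx hy
  grind

theorem card_inter_pair_le_two {a b : Sym2 V} : (X ∩ {a, b}).card ≤ 2 :=
  (Finset.card_le_card Finset.inter_subset_right).trans Finset.card_le_two

theorem sum_le_card_add_one {D : Finset V} {f : V → ℕ} (z : V) (hz : f z ≤ 2)
    (h : ∀ y ∈ D, y ≠ z → f y ≤ 1) : ∑ y ∈ D, f y ≤ D.card + 1 := by
  have h1 : ∑ y ∈ D, f y ≤ ∑ y ∈ D, (1 + if y = z then 1 else 0) := by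
    refine Finset.sum_le_sum fun y hy => ?_
    split_ifs with hyz
    · subst hyz; exact hz
    · exact h y hy hyz
  refine h1.trans ?_
  rw [Finset.sum_add_distrib, Finset.sum_ite_eq']
  simp only [Finset.sum_const, smul_eq_mul, mul_one]
  split_ifs <;> omega

/-- If P1 owns both edges at a page `y` of the spine `p c`, then `c y` meets `p q` only if `y = q`;
otherwise `c y` is the stray edge. So at most one page is doubled, once the two cases are kept from
occurring together. -/
theorem Answerable.card_le_of_common (h : Answerable B side p q T X Y) {c : V} {D : Finset V} (hpc : p ≠ c) (hcq : c ≠ q) (hp : p ∉ D)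
    (hside : side c = side p) : (X ∩ book p c D).card ≤ D.card + 2 := by
  have hT : ∀ y ∈ D, y ≠ q → s(c, y) ∈ X → s(c, y) ∈ T := by
    intro y hy hyq hyX
    rcases h.cover _ hyX with h' | h' | h' | h'
    · rcases Sym2.mem_iff.1 h' with h' | h'
      · exact absurd h' hpc
      · exact absurd (h' ▸ hy) hp
    · rcases Sym2.mem_iff.1 h' with h' | h'
      · exact absurd h'.symm hcq
      · exact absurd h'.symm hyq
    · have := (mem_onSide.1 h').2 c (by simp)
      rw [hside] at this
      simp at this
    · exact h'
  refine (card_inter_book_le _ _ _ _).trans ?_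
  have h1 : (X ∩ {s(p, c)}).card ≤ 1 :=
    (Finset.card_le_card Finset.inter_subset_right).trans (by simp)
  by_cases hex : ∃ y ∈ D, y ≠ q ∧ s(p, y) ∈ X ∧ s(c, y) ∈ X
  · obtain ⟨z, hz, hzq, hpz, hcz⟩ := hex
    obtain ⟨c', d, heq, h2, h3, h4, h5, h6, h7, h8⟩ := h.stray _ (hT z hz hzq hcz)
    -- P1 owns `p z`, so the endpoint `d` that P1 has not joined to `p` must be `c`. Then `p c` and
    -- `q c` are not P1's: the spine is lacking, and `q` is not a second doubled page.
    have hd : d = c := by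
      rw [Sym2.eq_iff] at heq
      rcases heq with ⟨rfl, rfl⟩ | ⟨rfl, rfl⟩
      · exact absurd hpz h6
      · rfl
    subst hd
    have h0 : (X ∩ {s(p, d)}).card = 0 := by
      rw [Finset.card_eq_zero, Finset.inter_singleton_of_notMem h6]
    have hsum : ∑ y ∈ D, (X ∩ {s(p, y), s(d, y)}).card ≤ D.card + 1 := by
      refine sum_le_card_add_one z card_inter_pair_le_two fun y hy hyz =>
        card_inter_pair_le_one fun hpy hdy => ?_
      by_cases hyq : y = q
      · subst hyq; rw [Sym2.eq_swap] at hdy; exact h7 hdy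
      · have := Finset.card_le_one.1 h.stray_unique _ (hT y hy hyq hdy) _ (hT z hz hzq hcz)
        exact hyz (Sym2.congr_right.1 this)
    omega
  · push Not at hex
    have hsum : ∑ y ∈ D, (X ∩ {s(p, y), s(c, y)}).card ≤ D.card + 1 :=
      sum_le_card_add_one q card_inter_pair_le_two fun y hy hyq =>
        card_inter_pair_le_one fun hpy hcy => hex y hy hyq hpy hcy
    omega

theorem FreeBook.same_side (A : Arena B side n) {r s : V} {D : Finset V}
    (hf : FreeBook (Taken B Y) r s D) : side r = side s ∧ ∀ c ∈ D, side c = side r := by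
  have key : ∀ x y, s(x, y) ∉ Taken B Y → side x = side y := fun x y h =>
    ((A.adj x y).1 (notMem_taken.1 h).1).2
  exact ⟨key _ _ hf.spine, fun c hc => (key _ _ (hf.left hc)).symm⟩

/-- A spine disjoint from `p q` meets P1's edges only in the four edges joining the two pairs and
the stray edge; the other clique holds at most five. The bound is 6 for four pages and 5 for three,
so away from `p q` one move of P1 creates neither a threat nor a three-page book. -/
theorem Answerable.card_le (h : Answerable B side p q T X Y) (A : Arena B side n) {r s : V} {D : Finset V} (hf : FreeBook (Taken B Y) r s D)
    (hD : 3 ≤ D.card) (hne : s(r, s) ≠ s(p, q)) : (X ∩ book r s D).card ≤ D.card + 2 := by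
  obtain ⟨hrs, hDs⟩ := hf.same_side A
  by_cases hside : side r = side p
  · by_cases hrp : r = p
    · subst hrp
      exact h.card_le_of_common hf.1 (fun h' => hne (by rw [h'])) hf.2.1 hrs.symm
    by_cases hrq : r = q
    · subst hrq
      exact h.symm.card_le_of_common hf.1 (fun h' => hne (by rw [h', Sym2.eq_swap]))
        hf.2.1 hrs.symm
    by_cases hsp : s = p
    · subst hsp
      rw [book_comm]
      exact h.card_le_of_common hf.1.symm hrq hf.2.2.1 hrs
    by_cases hsq : s = q
    · subst hsq
      rw [book_comm]
      exact h.symm.card_le_of_common hf.1.symm hrp hf.2.2.1 hrs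
    have hsub : X ∩ book r s D ⊆ ({s(r, p), s(s, p), s(r, q), s(s, q)} : Finset (Sym2 V)) ∪ T := by
      intro e he
      rw [Finset.mem_inter] at he
      rw [Finset.mem_union]
      have hspine : ∀ w, w ≠ r → w ≠ s → w ∈ e → e = s(r, w) ∨ e = s(s, w) := by
        intro w hwr hws hw
        rcases mem_book.1 he.2 with rfl | ⟨c, hc, rfl | rfl⟩
        · rcases Sym2.mem_iff.1 hw with h' | h'
          · exact absurd h' hwr
          · exact absurd h' hws
        · rcases Sym2.mem_iff.1 hw with h' | h'
          · exact absurd h' hwr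
          · exact Or.inl (by rw [h'])
        · rcases Sym2.mem_iff.1 hw with h' | h'
          · exact absurd h' hws
          · exact Or.inr (by rw [h'])
      rcases h.cover e he.1 with h' | h' | h' | h'
      · have := hspine p (Ne.symm hrp) (Ne.symm hsp) h'
        simp only [Finset.mem_insert, Finset.mem_singleton]
        tauto
      · have := hspine q (Ne.symm hrq) (Ne.symm hsq) h'
        simp only [Finset.mem_insert, Finset.mem_singleton]
        tauto
      · exfalso
        have h'' := (mem_onSide.1 h').2
        rcases mem_book.1 he.2 with rfl | ⟨c, hc, rfl | rfl⟩
        · have := h'' r (by simp); rw [hside] at this; simp at this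
        · have := h'' r (by simp); rw [hside] at this; simp at this
        · have := h'' s (by simp); rw [← hrs, hside] at this; simp at this
      · exact Or.inr h'
    have h4 : ({s(r, p), s(s, p), s(r, q), s(s, q)} : Finset (Sym2 V)).card ≤ 4 :=
      Finset.card_le_four
    have := (Finset.card_le_card hsub).trans (Finset.card_union_le _ _)
    have := h.stray_unique
    omega
  · have hsub : X ∩ book r s D ⊆ onSide side (!side p) X := by
      intro e he
      rw [Finset.mem_inter] at he
      refine mem_onSide.2 ⟨he.1, fun v hv => ?_⟩
      have hv' : side v = side r := by
        rcases mem_book.1 he.2 with rfl | ⟨c, hc, rfl | rfl⟩ <;>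
          rcases Sym2.mem_iff.1 hv with rfl | rfl
        · rfl
        · exact hrs.symm
        · rfl
        · exact hDs _ hc
        · exact hrs.symm
        · exact hDs _ hc
      rw [hv']
      exact Bool.eq_not.2 hside
    have := Finset.card_le_card hsub
    have := h.far
    omega

end Forcing

end RamseyGame
namespace RamseyGame

/-! ### From a finished core to the endless threats. -/

section Final

variable {V : Type*} [DecidableEq V] {B : SimpleGraph V} {σ : Strategy₁ B targetG} {m ℓ n : ℕ}
  {X Y : Finset (Sym2 V)} {side : V → Bool} {p q : V} {T : Finset (Sym2 V)}

theorem Answerable.atMost (h : Answerable B side p q T X Y) (A : Arena B side n) :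
    AtMost B 7 X Y := by
  intro r s D hD hf
  by_cases hne : s(r, s) = s(p, q)
  · have hsp : s(p, q) ∉ Taken B Y := hne ▸ hf.spine
    have hc := h.spine.resolve_left hsp
    rcases Sym2.eq_iff.1 hne with ⟨rfl, rfl⟩ | ⟨rfl, rfl⟩
    · exact (Finset.card_le_card (inter_book_subset_compat hf)).trans hc
    · rw [book_comm]
      exact (Finset.card_le_card (inter_book_subset_compat hf.symm)).trans hc
  · have := h.card_le A hf (by omega) hne
    omega

theorem Reach.freeBook (r : Reach σ m X Y ℓ) {u v : V} {D : Finset V} (huv : u ≠ v) (hu : u ∉ D)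
    (hv : v ∉ D) (hsub : book u v D ⊆ X) : FreeBook (Taken B Y) u v D :=
  ⟨huv, hu, hv, fun e he => notMem_taken.2 ⟨r.left_board e (hsub he), r.disjoint e (hsub he)⟩⟩

theorem card_insert_inter_le (e : Sym2 V) (X E : Finset (Sym2 V)) :
    (insert e X ∩ E).card ≤ (X ∩ E).card + 1 := by
  have h1 : insert e X ∩ E ⊆ insert e (X ∩ E) := by
    intro x hx
    simp only [Finset.mem_inter, Finset.mem_insert] at hx ⊢
    tauto
  exact (Finset.card_le_card h1).trans (Finset.card_insert_le _ _)

theorem Touched.insert_left {W : Finset V} (h : Touched W X Y) (e : Sym2 V) :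
    Touched (W ∪ e.toFinset) (insert e X) Y := by
  intro x hx v hv
  rw [Finset.mem_insert] at hx
  rw [Finset.mem_union, Sym2.mem_toFinset]
  rcases hx with (rfl | hx) | hx
  · exact Or.inr hv
  · exact Or.inl (h x (Or.inl hx) v hv)
  · exact Or.inl (h x (Or.inr hx) v hv)

theorem card_union_toFinset_le (W : Finset V) (e : Sym2 V) :
    (W ∪ e.toFinset).card ≤ W.card + 2 := by
  refine (Finset.card_union_le _ _).trans (Nat.add_le_add_left ?_ _)
  rw [Sym2.card_toFinset]
  split_ifs <;> omega

/-- Each threat and its answer preserve `Answerable`. The first move that is not a threat hands the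
position to `endless_threats`, and the decreasing `k` rules out threatening until move `m`. -/
theorem answer_threats (A : Arena B side n) (G : GuaranteesWinWithin σ m) {c₀ : ℕ}
    (hm : m + c₀ + 4 ≤ 2 * n) {a b : V} {C : Finset V} (hC : C.card = 3) (hab : a ≠ b)
    (haC : a ∉ C) (hbC : b ∉ C) :
    ∀ (k : ℕ) (X Y : Finset (Sym2 V)) (W : Finset V) (ℓ : ℕ), m ≤ ℓ + k → Even ℓ →
      Reach σ m X Y ℓ → book a b C ⊆ Y → Answerable B side p q T X Y → Touched W X Y →
      p ∈ W → q ∈ W → 2 * W.card ≤ ℓ + c₀ → False := by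
  intro k
  induction k using Nat.strong_induction_on with
  | _ k ih =>
  intro X Y W ℓ hk heven hr hY hA hW hpW hqW hcard
  have h7 := hA.atMost A
  have hno : NoCopy X := (h7.mono (by norm_num)).noCopy hr
  have hlt := (hr.running G hno).1
  obtain ⟨e, heB, heX, heY, hr1⟩ := hr.step_one G hno heven
  have hno1 : NoCopy (insert e X) := (h7.insert_left e).noCopy hr1
  have hlt1 := (hr1.running G hno1).1
  by_cases h71 : AtMost B 7 (insert e X) Y
  · have habY : s(a, b) ∈ Y := hY (mem_book.2 (Or.inl rfl))
    have key : ∀ z, (z ≠ p ∧ z ≠ q) ∨ s(p, q) ∈ Y → ∀ (s : V) (D : Finset V), D.card = 3 →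
        z ≠ s → z ∉ D → s ∉ D → ¬ book z s D ⊆ insert e X := by
      intro z hz s D hD hzs hzD hsD hsub
      have hf := hr1.freeBook hzs hzD hsD hsub
      have hne : s(z, s) ≠ s(p, q) := by
        intro heq
        rcases hz with hz | hz
        · rcases Sym2.eq_iff.1 heq with ⟨h, -⟩ | ⟨h, -⟩
          · exact hz.1 h
          · exact hz.2 h
        · exact hr1.disjoint _ (hsub (mem_book.2 (Or.inl rfl))) (heq ▸ hz)
      have h5 := hA.card_le A hf (by omega) hne
      have h6 := card_insert_inter_le e X (book z s D)
      rw [Finset.inter_eq_right.2 hsub, card_book hzs hzD hsD] at h6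
      omega
    have hW1 := hW.insert_left e
    have hW1c := card_union_toFinset_le W e
    -- The ends of the core's spine are interchangeable. If neither avoided `p q`, then `p q` would
    -- be the edge `a b` of P2 and harmless.
    by_cases hb : (b ≠ p ∧ b ≠ q) ∨ s(p, q) ∈ Y
    · exact endless_threats A G (c₀ := c₀ + 4) (by omega) hC hab haC hbC m _ _ _ _ (by omega)
        heven.add_one hr1 hY h71 (key b hb) hW1 (by omega)
    · have ha : (a ≠ p ∧ a ≠ q) ∨ s(p, q) ∈ Y := by
        by_contra hcon
        push Not at hb hcon
        have : s(p, q) = s(a, b) := by rw [Sym2.eq_iff]; grind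
        exact hb.2 (this ▸ habY)
      exact endless_threats A G (c₀ := c₀ + 4) (by omega) hC hab.symm hbC haC m _ _ _ _ (by omega)
        heven.add_one hr1 (by rw [book_comm]; exact hY) h71 (key a ha) hW1 (by omega)
  · have hthreat : ∃ D, D.card = 4 ∧ FreeBook (Taken B Y) p q D ∧
        8 ≤ (insert e X ∩ book p q D).card := by
      simp only [AtMost, not_forall, not_le] at h71
      obtain ⟨r, s, D, hD, hf, hgt⟩ := h71
      have hle := card_insert_inter_le e X (book r s D)
      have heq : s(r, s) = s(p, q) := by
        by_contra hne
        have := hA.card_le A hf (by omega) hne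
        omega
      rcases Sym2.eq_iff.1 heq with ⟨rfl, rfl⟩ | ⟨rfl, rfl⟩
      · exact ⟨D, hD, hf, hgt⟩
      · exact ⟨D, hD, hf.symm, by rw [book_comm]; exact hgt⟩
    obtain ⟨D, hD, hf, h8⟩ := hthreat
    have hle7 := h7 p q D hD hf
    have heD : e ∈ book p q D := by
      by_contra hn
      rw [Finset.insert_inter_of_notMem hn] at h8
      omega
    have hins : insert e X ∩ book p q D = insert e (X ∩ book p q D) :=
      Finset.insert_inter_of_mem heD
    have hc8 : (insert e X ∩ book p q D).card = (X ∩ book p q D).card + 1 := by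
      rw [hins, Finset.card_insert_of_notMem (by simp [heX])]
    -- The seven edges in this book exhaust the bound of `spine`, so P1 has no other edge usable
    -- with `p q`.
    have hcompat : X ∩ book p q D = compat (Taken B Y) X p q := by
      refine Finset.eq_of_subset_of_card_le (inter_book_subset_compat hf) ?_
      have := hA.spine.resolve_left hf.spine
      omega
    have hcb := card_book hf.1 hf.2.1 hf.2.2.1
    have hmiss : (book p q D \ insert e X).card = 1 := by
      have := Finset.card_sdiff_add_card_inter (book p q D) (insert e X)
      rw [Finset.inter_comm] at this
      omega
    obtain ⟨f, hfeq⟩ := Finset.card_eq_one.1 hmiss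
    have hfmem : f ∈ book p q D \ insert e X := by rw [hfeq]; simp
    rw [Finset.mem_sdiff] at hfmem
    have hin : ∀ g ∈ book p q D, g ≠ f → g ∈ insert e X := by
      intro g hg hgf
      by_contra hn
      have : g ∈ book p q D \ insert e X := Finset.mem_sdiff.2 ⟨hg, hn⟩
      rw [hfeq, Finset.mem_singleton] at this
      exact hgf this
    obtain ⟨hfB, hfY⟩ := notMem_taken.1 (hf.2.2.2 f hfmem.1)
    have hr2 := hr1.step_two G hno1 heven.add_one hfB hfmem.2 hfY
    have hfT : f ∈ Taken B (insert f Y) := Or.inr (Finset.mem_insert_self _ _)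
    have hTmono := taken_mono (B := B) (Finset.subset_insert f Y)
    have hpq_e : p ∈ e ∨ q ∈ e := by
      rcases mem_book.1 heD with rfl | ⟨c, -, rfl | rfl⟩ <;> simp
    have hpD : ∀ c ∈ D, c ≠ p := fun c hc h => hf.2.1 (h ▸ hc)
    have hqD : ∀ c ∈ D, c ≠ q := fun c hc h => hf.2.2.1 (h ▸ hc)
    have hfar : onSide side (!side p) (insert e X) = onSide side (!side p) X := by
      ext g
      rw [mem_onSide, mem_onSide, Finset.mem_insert]
      constructor
      · rintro ⟨rfl | hg, hs⟩
        · rcases hpq_e with h | h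
          · have := hs p h; simp at this
          · have := hs q h; rw [hA.side_eq] at this; simp at this
        · exact ⟨hg, hs⟩
      · exact fun h => ⟨Or.inr h.1, h.2⟩
    have hsp : s(p, q) ∈ Taken B (insert f Y) ∨
        (compat (Taken B (insert f Y)) (insert e X) p q).card ≤ 7 := by
      by_cases hfs : f = s(p, q)
      · exact Or.inl (hfs ▸ hfT)
      · right
        -- If `f` is one edge of a page, P1 owns the other, since `f` is the only lacking edge.
        -- Taking `f` makes that other edge useless, so eight usable edges become seven.
        have hsub : ∀ g, g ∈ insert e X ∩ book p q D → 
            g ∉ compat (Taken B (insert f Y)) (insert e X) p q →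
            (compat (Taken B (insert f Y)) (insert e X) p q).card ≤ 7 := by
          intro g hg hgc
          have h1 : compat (Taken B (insert f Y)) (insert e X) p q ⊆
              (insert e X ∩ book p q D).erase g := by
            intro y hy
            rw [Finset.mem_erase]
            refine ⟨fun h => hgc (h ▸ hy), ?_⟩
            obtain ⟨hy1, hy2⟩ := mem_compat.1 hy
            rw [hins, hcompat, Finset.mem_insert]
            rcases Finset.mem_insert.1 hy1 with hy1 | hy1
            · exact Or.inl hy1
            · refine Or.inr (mem_compat.2 ⟨hy1, hy2.imp id ?_⟩)
              rintro ⟨x, h1, h2, h3, h4, h5⟩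
              exact ⟨x, h1, h2, h3, fun h => h4 (hTmono h), fun h => h5 (hTmono h)⟩
          have := Finset.card_le_card h1
          rw [Finset.card_erase_of_mem hg] at this
          omega
        rcases mem_book.1 hfmem.1 with h | ⟨c, hc, h | h⟩
        · exact absurd h hfs
        · have hb : s(q, c) ∈ book p q D := mem_book.2 (Or.inr ⟨c, hc, Or.inr rfl⟩)
          refine hsub s(q, c) (Finset.mem_inter.2 ⟨hin _ hb ?_, hb⟩) ?_
          · rw [h]; intro h'; exact hA.ne (Sym2.congr_left.1 h').symm
          · intro hcon
            rcases (mem_compat.1 hcon).2 with h' | ⟨x, hxp, hxq, h', h4, h5⟩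
            · rw [Sym2.eq_iff] at h'
              have := hpD c hc
              have := hA.ne
              grind
            · have hxc : x = c := by
                rw [Sym2.eq_iff, Sym2.eq_iff] at h'
                have := hpD c hc
                have := hA.ne
                grind
              subst hxc
              exact h4 (h ▸ hfT)
        · have hb : s(p, c) ∈ book p q D := mem_book.2 (Or.inr ⟨c, hc, Or.inl rfl⟩)
          refine hsub s(p, c) (Finset.mem_inter.2 ⟨hin _ hb ?_, hb⟩) ?_
          · rw [h]; intro h'; exact hA.ne (Sym2.congr_left.1 h')
          · intro hcon
            rcases (mem_compat.1 hcon).2 with h' | ⟨x, hxp, hxq, h', h4, h5⟩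
            · have := Sym2.congr_right.1 h'
              exact hqD c hc this
            · have hxc : x = c := by
                rw [Sym2.eq_iff, Sym2.eq_iff] at h'
                have := hqD c hc
                have := hA.ne
                grind
              subst hxc
              exact h5 (h ▸ hfT)
    have hA2 : Answerable B side p q T (insert e X) (insert f Y) := by
      refine ⟨hA.ne, hA.side_eq, by rw [hfar]; exact hA.far, ?_, hA.stray_unique, ?_, hsp⟩
      · intro g hg
        rw [hfar]
        rcases Finset.mem_insert.1 hg with rfl | hg
        · tauto
        · exact hA.cover g hg
      · intro t ht
        obtain ⟨c, d, h1, h2, h3, h4, h5, h6, h7, h8⟩ := hA.stray t ht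
        -- A blocked vertex is not a page of an unblocked book, so P1's threat did not join `d` to
        -- `p` or `q`.
        have hd : d ∉ D := fun hd => h8.elim (hf.left hd) (hf.right hd)
        refine ⟨c, d, h1, h2, h3, h4, h5, ?_, ?_, h8.imp (fun h => hTmono h) fun h => hTmono h⟩
        · rw [Finset.mem_insert, not_or]
          refine ⟨?_, h6⟩
          rintro rfl
          have := hA.ne
          rcases mem_book.1 heD with h | ⟨x, hx, h | h⟩ <;> rw [Sym2.eq_iff] at h <;>
            have := hf.2.1 <;> grind
        · rw [Finset.mem_insert, not_or]
          refine ⟨?_, h7⟩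
          rintro rfl
          have := hA.ne
          rcases mem_book.1 heD with h | ⟨x, hx, h | h⟩ <;> rw [Sym2.eq_iff] at h <;>
            have := hf.2.2.1 <;> grind
    -- Since `p` and `q` lie in `W`, the threat brings at most one new vertex. The answer brings
    -- none: its page already carries an edge of P1.
    obtain ⟨z, hz⟩ : ∃ z, ∀ v ∈ e, v = z ∨ v ∈ W := by
      rcases mem_book.1 heD with rfl | ⟨c, -, rfl | rfl⟩
      · exact ⟨p, fun v hv => by rcases Sym2.mem_iff.1 hv with rfl | rfl <;> tauto⟩
      · exact ⟨c, fun v hv => by rcases Sym2.mem_iff.1 hv with rfl | rfl <;> tauto⟩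
      · exact ⟨c, fun v hv => by rcases Sym2.mem_iff.1 hv with rfl | rfl <;> tauto⟩
    have hW1 : ∀ g ∈ insert e X, ∀ v ∈ g, v ∈ insert z W := by
      intro g hg v hv
      rw [Finset.mem_insert]
      rcases Finset.mem_insert.1 hg with rfl | hg
      · exact hz v hv
      · exact Or.inr (hW g (Or.inl hg) v hv)
    have hWf : ∀ v ∈ f, v ∈ insert z W := by
      have hp' : p ∈ insert z W := Finset.mem_insert_of_mem hpW
      have hq' : q ∈ insert z W := Finset.mem_insert_of_mem hqW
      intro v hv
      rcases mem_book.1 hfmem.1 with h | ⟨c, hc, h | h⟩ <;> rw [h, Sym2.mem_iff] at hv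
      · rcases hv with rfl | rfl <;> assumption
      · rcases hv with rfl | rfl
        · exact hp'
        · refine hW1 s(q, v) (hin _ (mem_book.2 (Or.inr ⟨v, hc, Or.inr rfl⟩)) ?_) v (by simp)
          rw [h]; intro h'; exact hA.ne (Sym2.congr_left.1 h').symm
      · rcases hv with rfl | rfl
        · exact hq'
        · refine hW1 s(p, v) (hin _ (mem_book.2 (Or.inr ⟨v, hc, Or.inl rfl⟩)) ?_) v (by simp)
          rw [h]; intro h'; exact hA.ne (Sym2.congr_left.1 h')
    have hW2 : Touched (insert z W) (insert e X) (insert f Y) := by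
      intro g hg v hv
      rcases hg with hg | hg
      · exact hW1 g hg v hv
      · rcases Finset.mem_insert.1 hg with rfl | hg
        · exact hWf v hv
        · exact Finset.mem_insert_of_mem (hW g (Or.inr hg) v hv)
    have := Finset.card_insert_le z W
    exact ih (k - 1) (by omega) _ _ (insert z W) _ (by omega) (by
        rw [Nat.even_iff] at heven ⊢; omega) hr2 (hY.trans (Finset.subset_insert _ _)) hA2 hW2
      (Finset.mem_insert_of_mem hpW) (Finset.mem_insert_of_mem hqW) (by omega)

/-- The next move of P1 gives at most seven edges in a book, hence no threat; only a three-page book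
at the vertex of the forced replies could hurt. Five usable edges at `b` are too few for one.
Otherwise, books at both `a` and `b` would need `7 + 4 = 11` edges of P1 on this side, while after
the move there are at most ten. -/
theorem no_threats (A : Arena B side n) (G : GuaranteesWinWithin σ m) {c₀ : ℕ}
    (hm : m + c₀ + 4 ≤ 2 * n) {a b : V} {C : Finset V} (hC : C.card = 3) (hab : a ≠ b)
    (haC : a ∉ C) (hbC : b ∉ C) {W : Finset V} (heven : Even ℓ) (hr : Reach σ m X Y ℓ)
    (hY : book a b C ⊆ Y) (h6 : AtMost B 6 X Y) (hW : Touched W X Y) (hcard : 2 * W.card ≤ ℓ + c₀)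
    (hcore : (onSide side (side a) X).card ≤ 9 ∨
      ∀ s, s(b, s) ∉ Taken B Y → (compat (Taken B Y) X b s).card ≤ 5) : False := by
  have h7 : AtMost B 7 X Y := h6.mono (by norm_num)
  have hno : NoCopy X := (h7.mono (by norm_num)).noCopy hr
  obtain ⟨e, heB, heX, heY, hr1⟩ := hr.step_one G hno heven
  have h71 : AtMost B 7 (insert e X) Y := h6.insert_left e
  have habY : s(a, b) ∈ Y := hY (mem_book.2 (Or.inl rfl))
  have hW1 := hW.insert_left e
  have hW1c := card_union_toFinset_le W e
  by_cases hb : ∀ (s : V) (D : Finset V), D.card = 3 → b ≠ s → b ∉ D → s ∉ D →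
      ¬ book b s D ⊆ insert e X
  · exact endless_threats A G (c₀ := c₀ + 4) (by omega) hC hab haC hbC m _ _ _ _ (by omega)
      heven.add_one hr1 hY h71 hb hW1 (by omega)
  · simp only [not_forall, not_not] at hb
    obtain ⟨s, D, hD, hbs, hbD, hsD, hsub⟩ := hb
    have hf := hr1.freeBook hbs hbD hsD hsub
    have hcb := card_book hbs hbD hsD
    have hle := card_insert_inter_le e X (book b s D)
    rw [Finset.inter_eq_right.2 hsub] at hle
    rcases hcore with h9 | h5
    · refine endless_threats A G (c₀ := c₀ + 4) (by omega) hC hab.symm hbC haC m _ _ _ _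
        (by omega) heven.add_one hr1 (by rw [book_comm]; exact hY) h71 ?_ hW1 (by omega)
      intro s' D' hD' has' haD' hsD' hsub'
      have hf' := hr1.freeBook has' haD' hsD' hsub'
      have hsab : side a = side b := ((A.adj a b).1 (hr.right_board _ habY)).2
      have hnot : s(b, a) ∉ insert e X := fun h => hr1.disjoint _ h (by rw [Sym2.eq_swap]; exact habY)
      have has : a ≠ s := by
        rintro rfl; exact hnot (hsub (mem_book.2 (Or.inl rfl)))
      have haD : a ∉ D := fun h => hnot (hsub (mem_book.2 (Or.inr ⟨a, h, Or.inl rfl⟩)))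
      -- Since `a b` belongs to P2, `a` lies outside P1's book at `b`, so the four edges from `a`
      -- are additional.
      have hdisj : Disjoint (book b s D) ((insert s' D').image fun v => s(a, v)) := by
        rw [Finset.disjoint_left]
        intro g hg hg'
        obtain ⟨v, -, rfl⟩ := Finset.mem_image.1 hg'
        rcases mem_book.1 hg with h | ⟨c, hc, h | h⟩ <;> rw [Sym2.eq_iff] at h <;> grind
      have hsubset : book b s D ∪ ((insert s' D').image fun v => s(a, v)) ⊆
          insert e (onSide side (side a) X) := by
        have hs1 := hf.same_side A
        have hs2 := hf'.same_side A
        have hpos : ∀ g ∈ insert e X, (∀ v ∈ g, side v = side a) →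
            g ∈ insert e (onSide side (side a) X) := by
          intro g hg hv
          rw [Finset.mem_insert] at hg ⊢
          exact hg.imp id fun hg => mem_onSide.2 ⟨hg, hv⟩
        intro g hg
        rcases Finset.mem_union.1 hg with hg | hg
        · refine hpos g (hsub hg) ?_
          intro v hv
          rw [hsab]
          rcases mem_book.1 hg with rfl | ⟨c, hc, rfl | rfl⟩ <;>
            rcases Sym2.mem_iff.1 hv with rfl | rfl
          · rfl
          · exact hs1.1.symm
          · rfl
          · exact hs1.2 _ hc
          · exact hs1.1.symm
          · exact hs1.2 _ hc
        · obtain ⟨v, hv, rfl⟩ := Finset.mem_image.1 hg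
          rw [Finset.mem_insert] at hv
          refine hpos _ (hsub' ?_) ?_
          · rcases hv with rfl | hv
            · exact mem_book.2 (Or.inl rfl)
            · exact mem_book.2 (Or.inr ⟨v, hv, Or.inl rfl⟩)
          · intro w hw
            rcases Sym2.mem_iff.1 hw with rfl | rfl
            · rfl
            · rcases hv with rfl | hv
              · exact hs2.1.symm
              · exact hs2.2 _ hv
      have := Finset.card_le_card hsubset
      rw [Finset.card_union_of_disjoint hdisj,
        Finset.card_image_of_injective _ fun x y h => Sym2.congr_right.1 h,
        Finset.card_insert_of_notMem hsD'] at this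
      have := Finset.card_insert_le e (onSide side (side a) X)
      omega
    · have := Finset.card_le_card (inter_book_subset_compat (X := X) hf)
      have := h5 s hf.spine
      omega

end Final

end RamseyGame
-- Diagrams and P2's decision tree for building a core.
namespace RamseyGame

/-- What the second player keeps track of while building a core: the vertices used are numbered by
`0, …, size - 1`, `own` lists the claimed pairs, `seen` pairs that the first player is known to
have taken, `free` pairs known to be unclaimed, and at most `slack + 1` edges of the first
player are not in `seen`. -/
structure Diagram where
  size : ℕ
  own : List (ℕ × ℕ)
  seen : List (ℕ × ℕ)
  free : List (ℕ × ℕ)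
  slack : ℕ

namespace Diagram

variable (S : Diagram)

def adj (i j : ℕ) : Bool := S.own.contains (i, j) || S.own.contains (j, i)

def blocked (i j x : ℕ) : Bool := S.adj i x || S.adj j x

/-- The pair `e` can lie in a book of the first player with spine `i j`. -/
def fits (i j : ℕ) (e : ℕ × ℕ) : Bool :=
  ((e.1 == i || e.1 == j) && (e.2 == i || e.2 == j)) ||
    ((e.1 == i || e.1 == j) && !S.blocked i j e.2) ||
    ((e.2 == i || e.2 == j) && !S.blocked i j e.1)

/-- An upper bound for the number of edges of the first player in a book with spine `i j`. -/
def load (i j : ℕ) : ℕ := S.slack + (S.seen.filter (S.fits i j)).length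

/-- `P` holds for all pairs that are not claimed; the index `size` stands for any vertex without a
number. -/
def forallFree (P : ℕ → ℕ → Bool) : Bool :=
  (List.range (S.size + 1)).all fun i => (List.range (S.size + 1)).all fun j =>
    S.adj i j || (i == j && i != S.size) || P i j

/-- Ensures that P1 has not won when P2 is to move. If `own.length ≤ 7`, P1 has at most eight edges,
too few for a copy. -/
def tame : Bool :=
  decide (S.slack ≤ 6) &&
    (decide (S.own.length ≤ 7) || S.forallFree fun i j => decide (S.load i j ≤ 7))

def claim (q : ℕ × ℕ) : Diagram :=
  { S with own := q :: S.own, free := S.free.filter (· != q) }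

def extend (i : ℕ) : Diagram :=
  { S with
    size := S.size + 1
    own := (i, S.size) :: S.own
    free := S.free ++ ((List.range S.size).filter (· != i)).map fun x => (x, S.size) }

def see (q : ℕ × ℕ) : Diagram :=
  { S with seen := q :: S.seen, free := S.free.filter (· != q) }

/-- P1's move has not been located, so only the pairs tested against it are still known to be free.
-/
def pass (asked : List (ℕ × ℕ)) : Diagram :=
  { S with slack := S.slack + 1, free := asked }

def isCore (a b c₁ c₂ c₃ : ℕ) : Bool :=
  S.adj a b && S.adj a c₁ && S.adj a c₂ && S.adj a c₃ && S.adj b c₁ && S.adj b c₂ && S.adj b c₃ &&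
    c₁ != c₂ && c₁ != c₃ && c₂ != c₃

/-- Meant for eight edges of P1 on the side of the core: a spine that uses seven leaves one over,
and the second alternative gives that one the property required by `Answerable.stray`. -/
def nineSafe : Bool :=
  S.forallFree fun i j => decide (S.load i j ≤ 6) ||
    (decide (S.load i j ≤ 7) && S.seen.all fun e => S.fits i j e ||
      (e.1 != i && e.1 != j && e.2 != i && e.2 != j && (S.blocked i j e.1 || S.blocked i j e.2)))

/-- Five usable edges and one more move do not give the seven edges of a three-page book at `b`. -/
def endSafe (b : ℕ) : Bool :=
  (List.range (S.size + 1)).all fun j => S.adj b j || b == j || decide (S.load b j ≤ 5)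

/-- Once the second player has a core, the first player cannot win in time. -/
def safe (b : ℕ) : Bool :=
  decide (S.own.length ≤ 8) || (decide (S.own.length ≤ 9) && S.nineSafe) ||
    ((S.forallFree fun i j => decide (S.load i j ≤ 6)) &&
      (decide (S.own.length ≤ 10) || S.endSafe b))

end Diagram

/-- A strategy of the second player for building a core. The nodes `finish` and `move` are moves of
the second player; the nodes `ask` and `other` distinguish the replies of the first player. -/
inductive Plan where
  | finish (i j a b c₁ c₂ c₃ : ℕ)
  | move (i j : ℕ) (next : Plan)
  | ask (x y : ℕ) (hit miss : Plan)
  | other (next : Plan)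

/-- The plan leads to a safe core. The last argument is `none` if the second player is to move,
and `some asked` if the last move of the first player is being inspected and was found not to be
one of the pairs `asked`. -/
def Plan.valid : Plan → Diagram → Option (List (ℕ × ℕ)) → Bool
  | finish i j a b c₁ c₂ c₃, S, none =>
    S.tame && decide (S.own.length ≤ 10) && S.free.contains (i, j) &&
      (S.claim (i, j)).isCore a b c₁ c₂ c₃ && (S.claim (i, j)).safe b
  | move i j next, S, none =>
    S.tame && decide (S.own.length ≤ 10) &&
      ((decide (i < S.size) && j == S.size && next.valid (S.extend i) (some [])) ||
        (S.free.contains (i, j) && next.valid (S.claim (i, j)) (some [])))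
  | ask x y hit miss, S, some asked =>
    S.free.contains (x, y) && hit.valid (S.see (x, y)) none &&
      miss.valid S (some ((x, y) :: asked))
  | other next, S, some asked => next.valid (S.pass asked) none
  | _, _, _ => false

def coreDiagram : Diagram := ⟨2, [(0, 1)], [], [], 0⟩

namespace Plan

/-- A plan that starts after the second player took the pair `0 1`. -/
def corePlan : Plan :=
  other (move 0 2 (ask 1 2 (move 0 3 (ask 2 3 (move 1 3 (other (move 0 4 (ask 3 4 (move 1 4 (ask 2
  4 (move 1 5 (ask 0 5 (move 1 6 (ask 0 6 (move 1 7 (ask 0 7 (move 3 5 (ask 3 6 (finish 3 7 3 1 0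
  5 7) (other (finish 3 6 3 1 0 5 6)))) (other (finish 0 7 1 0 3 4 7)))) (other (finish 0 6 1 0 3
  4 6)))) (other (finish 0 5 1 0 3 4 5)))) (other (move 2 4 (other (move 0 5 (ask 1 5 (finish 4 5
  4 0 1 2 5) (other (finish 1 5 1 0 3 4 5))))))))) (ask 2 4 (move 1 4 (ask 3 4 (move 1 5 (ask 0 5
  (move 1 6 (ask 0 6 (move 1 7 (ask 0 7 (move 3 5 (ask 3 6 (finish 3 7 3 1 0 5 7) (other (finish 3
  6 3 1 0 5 6)))) (other (finish 0 7 1 0 3 4 7)))) (other (finish 0 6 1 0 3 4 6)))) (other (finish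
  0 5 1 0 3 4 5)))) (other (move 1 5 (ask 0 5 (move 3 4 (ask 3 5 (finish 4 5 4 1 0 3 5) (other
  (finish 3 5 3 1 0 4 5)))) (other (finish 0 5 1 0 3 4 5))))))) (ask 1 4 (move 3 4 (ask 2 4 (move
  3 5 (ask 0 5 (move 3 6 (ask 0 6 (move 3 7 (ask 0 7 (move 1 5 (ask 1 6 (finish 1 7 1 3 0 5 7)
  (other (finish 1 6 1 3 0 5 6)))) (other (finish 0 7 3 0 1 4 7)))) (other (finish 0 6 3 0 1 4
  6)))) (other (finish 0 5 3 0 1 4 5)))) (other (move 2 4 (other (move 0 5 (ask 3 5 (finish 4 5 4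
  0 2 3 5) (other (finish 3 5 3 0 1 4 5))))))))) (other (move 2 4 (ask 3 4 (move 1 4 (other (move
  0 5 (ask 1 5 (finish 4 5 4 0 1 2 5) (other (finish 1 5 1 0 3 4 5)))))) (ask 1 4 (move 3 4 (other
  (move 0 5 (ask 3 5 (finish 4 5 4 0 2 3 5) (other (finish 3 5 3 0 1 4 5)))))) (other (move 1 4
  (ask 3 4 (move 0 5 (ask 1 5 (finish 4 5 4 0 1 2 5) (other (finish 1 5 1 0 3 4 5)))) (other
  (finish 3 4 4 0 1 2 3))))))))))))))) (ask 1 3 (move 2 3 (other (move 0 4 (ask 3 4 (move 2 4 (ask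
  1 4 (move 2 5 (ask 0 5 (move 2 6 (ask 0 6 (move 2 7 (ask 0 7 (move 3 5 (ask 3 6 (finish 3 7 3 2
  0 5 7) (other (finish 3 6 3 2 0 5 6)))) (other (finish 0 7 2 0 3 4 7)))) (other (finish 0 6 2 0
  3 4 6)))) (other (finish 0 5 2 0 3 4 5)))) (other (move 1 4 (other (move 0 5 (ask 2 5 (finish 4
  5 4 0 1 2 5) (other (finish 2 5 2 0 3 4 5))))))))) (ask 2 4 (move 3 4 (ask 1 4 (move 3 5 (ask 0
  5 (move 3 6 (ask 0 6 (move 3 7 (ask 0 7 (move 2 5 (ask 2 6 (finish 2 7 2 3 0 5 7) (other (finish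
  2 6 2 3 0 5 6)))) (other (finish 0 7 3 0 2 4 7)))) (other (finish 0 6 3 0 2 4 6)))) (other
  (finish 0 5 3 0 2 4 5)))) (other (move 1 4 (other (move 0 5 (ask 3 5 (finish 4 5 4 0 1 3 5)
  (other (finish 3 5 3 0 2 4 5))))))))) (ask 1 4 (move 2 4 (ask 3 4 (move 2 5 (ask 0 5 (move 2 6
  (ask 0 6 (move 2 7 (ask 0 7 (move 3 5 (ask 3 6 (finish 3 7 3 2 0 5 7) (other (finish 3 6 3 2 0 5
  6)))) (other (finish 0 7 2 0 3 4 7)))) (other (finish 0 6 2 0 3 4 6)))) (other (finish 0 5 2 0 3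
  4 5)))) (other (move 2 5 (ask 0 5 (move 3 4 (ask 3 5 (finish 4 5 4 2 0 3 5) (other (finish 3 5 3
  2 0 4 5)))) (other (finish 0 5 2 0 3 4 5))))))) (other (move 1 4 (ask 3 4 (move 2 4 (other (move
  0 5 (ask 2 5 (finish 4 5 4 0 1 2 5) (other (finish 2 5 2 0 3 4 5)))))) (ask 2 4 (move 3 4 (other
  (move 0 5 (ask 3 5 (finish 4 5 4 0 1 3 5) (other (finish 3 5 3 0 2 4 5)))))) (other (move 2 4
  (ask 3 4 (move 0 5 (ask 2 5 (finish 4 5 4 0 1 2 5) (other (finish 2 5 2 0 3 4 5)))) (other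
  (finish 3 4 4 0 1 2 3))))))))))))))) (other (move 1 3 (ask 2 3 (move 0 4 (ask 3 4 (move 1 4 (ask
  2 4 (move 1 5 (ask 0 5 (move 1 6 (ask 0 6 (move 1 7 (ask 0 7 (move 3 5 (ask 3 6 (finish 3 7 3 1
  0 5 7) (other (finish 3 6 3 1 0 5 6)))) (other (finish 0 7 1 0 3 4 7)))) (other (finish 0 6 1 0
  3 4 6)))) (other (finish 0 5 1 0 3 4 5)))) (other (move 2 4 (other (move 0 5 (ask 1 5 (finish 4
  5 4 0 1 2 5) (other (finish 1 5 1 0 3 4 5))))))))) (ask 2 4 (move 1 4 (ask 3 4 (move 1 5 (ask 0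
  5 (move 1 6 (ask 0 6 (move 1 7 (ask 0 7 (move 3 5 (ask 3 6 (finish 3 7 3 1 0 5 7) (other (finish
  3 6 3 1 0 5 6)))) (other (finish 0 7 1 0 3 4 7)))) (other (finish 0 6 1 0 3 4 6)))) (other
  (finish 0 5 1 0 3 4 5)))) (other (move 1 5 (ask 0 5 (move 3 4 (ask 3 5 (finish 4 5 4 1 0 3 5)
  (other (finish 3 5 3 1 0 4 5)))) (other (finish 0 5 1 0 3 4 5))))))) (ask 1 4 (move 3 4 (ask 2 4
  (move 3 5 (ask 0 5 (move 3 6 (ask 0 6 (move 3 7 (ask 0 7 (move 1 5 (ask 1 6 (finish 1 7 1 3 0 5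
  7) (other (finish 1 6 1 3 0 5 6)))) (other (finish 0 7 3 0 1 4 7)))) (other (finish 0 6 3 0 1 4
  6)))) (other (finish 0 5 3 0 1 4 5)))) (other (move 2 4 (other (move 0 5 (ask 3 5 (finish 4 5 4
  0 2 3 5) (other (finish 3 5 3 0 1 4 5))))))))) (other (move 2 4 (ask 3 4 (move 1 4 (other (move
  0 5 (ask 1 5 (finish 4 5 4 0 1 2 5) (other (finish 1 5 1 0 3 4 5)))))) (ask 1 4 (move 3 4 (other
  (move 0 5 (ask 3 5 (finish 4 5 4 0 2 3 5) (other (finish 3 5 3 0 1 4 5)))))) (other (move 1 4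
  (ask 3 4 (move 0 5 (ask 1 5 (finish 4 5 4 0 1 2 5) (other (finish 1 5 1 0 3 4 5)))) (other
  (finish 3 4 4 0 1 2 3))))))))))))) (other (move 2 3 (other (move 0 4 (ask 3 4 (move 1 4 (other
  (move 0 5 (ask 1 5 (finish 3 5 3 0 1 2 5) (other (finish 1 5 1 0 3 4 5)))))) (other (finish 3 4
  3 0 1 2 4))))))))))))) (other (move 1 2 (other (move 0 3 (ask 2 3 (move 1 3 (other (move 0 4
  (ask 1 4 (move 2 4 (other (move 0 5 (ask 1 5 (finish 2 5 2 0 1 4 5) (other (finish 1 5 1 0 2 3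
  5)))))) (other (finish 1 4 1 0 2 3 4)))))) (ask 1 3 (move 2 3 (other (move 0 4 (ask 2 4 (move 1
  4 (other (move 0 5 (ask 1 5 (finish 2 5 2 0 1 3 5) (other (finish 1 5 1 0 2 4 5)))))) (other
  (finish 2 4 2 0 1 3 4)))))) (other (move 1 3 (ask 2 3 (move 0 4 (ask 1 4 (move 2 4 (other (move
  0 5 (ask 1 5 (finish 2 5 2 0 1 4 5) (other (finish 1 5 1 0 2 3 5)))))) (other (finish 1 4 1 0 2
  3 4)))) (other (move 0 4 (ask 1 4 (move 2 3 (ask 2 4 (finish 3 4 3 0 1 2 4) (other (finish 2 4 2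
  0 1 3 4)))) (other (finish 1 4 1 0 2 3 4))))))))))))))))

end Plan

-- The whole case analysis of core building, done by evaluation.
set_option maxRecDepth 100000 in
theorem corePlan_valid : Plan.corePlan.valid coreDiagram (some []) = true := by
  decide +kernel

end RamseyGame
namespace RamseyGame

/-! ### Diagrams as sound descriptions of actual positions. -/

section Numbering

variable {V : Type*}

/-- `i` is the number of the vertex `v`. -/
def IsNumber (φ : ℕ → V) (k : ℕ) (v : V) (i : ℕ) : Prop :=
  (i < k ∧ φ i = v) ∨ (i = k ∧ ∀ j < k, φ j ≠ v)

theorem exists_isNumber (φ : ℕ → V) (k : ℕ) (v : V) : ∃ i, IsNumber φ k v i := by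
  by_cases h : ∃ j < k, φ j = v
  · obtain ⟨j, hj, rfl⟩ := h
    exact ⟨j, Or.inl ⟨hj, rfl⟩⟩
  · push Not at h
    exact ⟨k, Or.inr ⟨rfl, h⟩⟩

theorem IsNumber.le {φ : ℕ → V} {k i : ℕ} {v : V} (h : IsNumber φ k v i) : i ≤ k := by
  rcases h with h | h <;> omega

end Numbering

section Building

variable {V : Type*} [DecidableEq V] {B : SimpleGraph V} {σ : Strategy₁ B targetG} {m ℓ n : ℕ}
  {X Y : Finset (Sym2 V)} {side : V → Bool} {β : Bool} {φ : ℕ → V} {S : Diagram} {W : Finset V}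

/-- The edge with the numbers `q`. -/
def edgeOf (φ : ℕ → V) (q : ℕ × ℕ) : Sym2 V := s(φ q.1, φ q.2)

/-- The diagram describes the position in which the players have the edges `X` and `Y`. -/
structure Depicts (side : V → Bool) (β : Bool) (φ : ℕ → V) (S : Diagram) (X Y : Finset (Sym2 V))
    (W : Finset V) : Prop where
  inj : ∀ i < S.size, ∀ j < S.size, φ i = φ j → i = j
  side_eq : ∀ i < S.size, side (φ i) = β
  mem : ∀ i < S.size, φ i ∈ W
  own_lt : ∀ q ∈ S.own, q.1 < S.size ∧ q.2 < S.size ∧ q.1 ≠ q.2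
  own_iff : ∀ e, e ∈ Y ↔ ∃ q ∈ S.own, e = edgeOf φ q
  seen_lt : ∀ q ∈ S.seen, q.1 < S.size ∧ q.2 < S.size
  free : ∀ q ∈ S.free, q.1 < q.2 ∧ q.2 < S.size ∧ edgeOf φ q ∉ X ∧ edgeOf φ q ∉ Y
  slack : (X \ (S.seen.map (edgeOf φ)).toFinset).card ≤ S.slack + 1
  away : ∃ e ∈ X, e ∈ onSide side (!β) X
  touched : Touched W X Y

namespace Depicts

theorem isNumber (D : Depicts side β φ S X Y W) {i : ℕ} (hi : i < S.size) {v : V} {j : ℕ}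
    (h : IsNumber φ S.size v j) (hv : φ i = v) : j = i := by
  rcases h with ⟨h1, h2⟩ | ⟨h1, h2⟩
  · exact D.inj _ h1 _ hi (h2.trans hv.symm)
  · exact absurd hv (h2 i hi)

theorem mem_of_adj_lt (D : Depicts side β φ S X Y W) {i j : ℕ} (h : S.adj i j = true) :
    i < S.size ∧ j < S.size ∧ i ≠ j ∧ s(φ i, φ j) ∈ Y := by
  simp only [Diagram.adj, Bool.or_eq_true, List.contains_iff_mem] at h
  rcases h with h | h
  · have := D.own_lt _ h
    exact ⟨this.1, this.2.1, this.2.2, (D.own_iff _).2 ⟨_, h, rfl⟩⟩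
  · have := D.own_lt _ h
    exact ⟨this.2.1, this.1, this.2.2.symm, (D.own_iff _).2 ⟨_, h, Sym2.eq_swap⟩⟩

theorem mem_of_adj (D : Depicts side β φ S X Y W) {i j : ℕ} {v w : V}
    (hi : IsNumber φ S.size v i) (hj : IsNumber φ S.size w j) (h : S.adj i j = true) :
    s(v, w) ∈ Y := by
  obtain ⟨h1, h2, -, h3⟩ := D.mem_of_adj_lt h
  rcases hi with ⟨_, rfl⟩ | ⟨hi, _⟩
  · rcases hj with ⟨_, rfl⟩ | ⟨hj, _⟩
    · exact h3
    · omega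
  · omega

/-- All unnumbered vertices share the index `size`, so equal indices force equal vertices only below
`size`. This is why `Diagram.forallFree` keeps that one diagonal entry. -/
theorem forallFree (D : Depicts side β φ S X Y W) {P : ℕ → ℕ → Bool} (h : S.forallFree P = true)
    {i j : ℕ} {v w : V} (hi : IsNumber φ S.size v i) (hj : IsNumber φ S.size w j) (hvw : v ≠ w)
    (hf : s(v, w) ∉ Y) : P i j = true := by
  simp only [Diagram.forallFree, List.all_eq_true, List.mem_range, Bool.or_eq_true,
    Bool.and_eq_true, beq_iff_eq, bne_iff_ne] at h
  rcases h i (Nat.lt_succ_of_le hi.le) j (Nat.lt_succ_of_le hj.le) with (h | ⟨rfl, h⟩) | h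
  · exact absurd (D.mem_of_adj hi hj h) hf
  · rcases hi with ⟨hi, rfl⟩ | ⟨hi, _⟩
    · rcases hj with ⟨hj, rfl⟩ | ⟨hj, _⟩
      · exact absurd rfl hvw
      · omega
    · omega
  · exact h

theorem not_blocked (D : Depicts side β φ S X Y W) {i j x : ℕ} {r s : V} (hx : x < S.size)
    (hi : IsNumber φ S.size r i) (hj : IsNumber φ S.size s j)
    (h1 : s(r, φ x) ∉ Taken B Y) (h2 : s(s, φ x) ∉ Taken B Y) : S.blocked i j x = false := by
  by_contra h
  simp only [Diagram.blocked, Bool.not_eq_false, Bool.or_eq_true] at h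
  rcases h with h | h
  · exact (notMem_taken.1 h1).2 (D.mem_of_adj hi (Or.inl ⟨hx, rfl⟩) h)
  · exact (notMem_taken.1 h2).2 (D.mem_of_adj hj (Or.inl ⟨hx, rfl⟩) h)

theorem fits (D : Depicts side β φ S X Y W) {i j : ℕ} {r s : V}
    (hi : IsNumber φ S.size r i) (hj : IsNumber φ S.size s j) {q : ℕ × ℕ} (hq : q ∈ S.seen)
    (h : edgeOf φ q ∈ compat (Taken B Y) X r s) : S.fits i j q = true := by
  obtain ⟨h1, h2⟩ := D.seen_lt q hq
  obtain ⟨u, w⟩ := q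
  have num : ∀ {x y : ℕ} {v : V}, x < S.size → IsNumber φ S.size v y → φ x = v → x = y :=
    fun hx hn hv => (D.isNumber hx hn hv).symm
  simp only [Diagram.fits, Bool.or_eq_true, Bool.and_eq_true, beq_iff_eq, Bool.not_eq_true']
  simp only [edgeOf, mem_compat, Sym2.eq_iff] at h h1 h2
  rcases h.2 with (⟨a, b⟩ | ⟨a, b⟩) | ⟨x, -, -, ((⟨a, b⟩ | ⟨a, b⟩) | (⟨a, b⟩ | ⟨a, b⟩)), c, d⟩
  · exact Or.inl (Or.inl ⟨Or.inl (num h1 hi a), Or.inr (num h2 hj b)⟩)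
  · exact Or.inl (Or.inl ⟨Or.inr (num h1 hj a), Or.inl (num h2 hi b)⟩)
  · subst b
    exact Or.inl (Or.inr ⟨Or.inl (num h1 hi a), D.not_blocked h2 hi hj c d⟩)
  · subst a
    exact Or.inr ⟨Or.inl (num h2 hi b), D.not_blocked h1 hi hj c d⟩
  · subst b
    exact Or.inl (Or.inr ⟨Or.inr (num h1 hj a), D.not_blocked h2 hi hj c d⟩)
  · subst a
    exact Or.inr ⟨Or.inr (num h2 hj b), D.not_blocked h1 hi hj c d⟩

theorem away_subset (D : Depicts side β φ S X Y W) :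
    onSide side (!β) X ⊆ X \ (S.seen.map (edgeOf φ)).toFinset := by
  intro e he
  rw [mem_onSide] at he
  simp only [Finset.mem_sdiff, List.mem_toFinset, List.mem_map, not_exists, not_and]
  refine ⟨he.1, fun q hq hqe => ?_⟩
  have h1 : φ q.1 ∈ e := hqe ▸ Sym2.mem_mk_left _ _
  have h2 := he.2 _ h1
  rw [D.side_eq _ (D.seen_lt q hq).1] at h2
  cases β <;> simp at h2

theorem card_away_le (D : Depicts side β φ S X Y W) : (onSide side (!β) X).card ≤ S.slack + 1 :=
  (Finset.card_le_card D.away_subset).trans D.slack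

/-- P1's edge in the other clique is never seen, and it accounts for the `+ 1` in the slack
condition. -/
theorem card_unseen_le (D : Depicts side β φ S X Y W) :
    (onSide side β X \ (S.seen.map (edgeOf φ)).toFinset).card ≤ S.slack := by
  obtain ⟨e, -, he⟩ := D.away
  have h : onSide side β X \ (S.seen.map (edgeOf φ)).toFinset ⊂
      X \ (S.seen.map (edgeOf φ)).toFinset := by
    rw [Finset.ssubset_iff_of_subset]
    · refine ⟨e, D.away_subset he, fun h => ?_⟩
      rw [Finset.mem_sdiff, mem_onSide] at h
      rw [mem_onSide] at he
      induction e with | _ x y =>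
      have h1 := h.1.2 x (Sym2.mem_mk_left _ _)
      have h2 := he.2 x (Sym2.mem_mk_left _ _)
      rw [h1] at h2
      cases β <;> simp at h2
    · exact Finset.sdiff_subset_sdiff (fun e he => (mem_onSide.1 he).1) le_rfl
  have := Finset.card_lt_card h
  have := D.slack
  omega

end Depicts

theorem compat_subset_onSide (A : Arena B side n) (r : Reach σ m X Y ℓ) {u v : V}
    (huv : side u = side v) : compat (Taken B Y) X u v ⊆ onSide side (side u) X := by
  intro e he
  rw [mem_compat] at he
  rw [mem_onSide]
  refine ⟨he.1, ?_⟩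
  have hb := r.left_board e he.1
  rcases he.2 with rfl | ⟨x, -, -, (rfl | rfl), -, -⟩ <;>
  · rw [mem_edgeSet, A.adj] at hb
    intro w hw
    rcases Sym2.mem_iff.1 hw with rfl | rfl <;> grind

theorem card_onSide_add (A : Arena B side n) (r : Reach σ m X Y ℓ) (β : Bool) :
    (onSide side β X).card + (onSide side (!β) X).card = X.card := by
  rw [← Finset.card_union_of_disjoint]
  · congr 1
    ext e
    simp only [Finset.mem_union, mem_onSide]
    refine ⟨fun h => h.elim And.left And.left, fun h => ?_⟩
    have hb := r.left_board e h
    induction e with | _ x y =>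
    rw [mem_edgeSet, A.adj] at hb
    by_cases hx : side x = β
    · left; refine ⟨h, fun v hv => ?_⟩
      rcases Sym2.mem_iff.1 hv with rfl | rfl <;> simp [← hb.2, hx]
    · right; refine ⟨h, fun v hv => ?_⟩
      rcases Sym2.mem_iff.1 hv with rfl | rfl <;> simpa [← hb.2] using Bool.eq_not_of_ne hx
  · rw [Finset.disjoint_left]
    intro e h1 h2
    rw [mem_onSide] at h1 h2
    induction e with | _ x y =>
    have h3 := h1.2 x (Sym2.mem_mk_left _ _)
    have h4 := h2.2 x (Sym2.mem_mk_left _ _)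
    rw [h3] at h4
    cases β <;> simp at h4

/-- If the spines on the side `β` satisfy the bound, and the other side has few edges, so do
all books. -/
theorem atMost_of_spines (A : Arena B side n) {k : ℕ}
    (haway : (onSide side (!β) X).card ≤ k)
    (h : ∀ u v, u ≠ v → side u = β → side v = β → s(u, v) ∉ Taken B Y →
      (compat (Taken B Y) X u v).card ≤ k) (r : Reach σ m X Y ℓ) : AtMost B k X Y := by
  intro u v E _ hf
  refine (Finset.card_le_card (inter_book_subset_compat hf)).trans ?_
  have hs := (hf.same_side A).1
  by_cases hu : side u = β
  · exact h u v hf.1 hu (hs ▸ hu) hf.spine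
  · refine (Finset.card_le_card (compat_subset_onSide A r hs)).trans ?_
    rwa [Bool.eq_not_of_ne hu]

namespace Depicts

theorem subset_seen (A : Arena B side n) (D : Depicts side β φ S X Y W)
    (r : Reach σ m X Y ℓ) {i j : ℕ} {u v : V} (hi : IsNumber φ S.size u i)
    (hj : IsNumber φ S.size v j) (hu : side u = β) (hv : side v = β) :
    compat (Taken B Y) X u v ⊆ (onSide side β X \ (S.seen.map (edgeOf φ)).toFinset) ∪
      ((S.seen.filter (S.fits i j)).map (edgeOf φ)).toFinset := by
  intro e he
  have h1 := compat_subset_onSide A r (hu.trans hv.symm) he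
  rw [hu] at h1
  rw [Finset.mem_union, Finset.mem_sdiff]
  by_cases h : ∃ q ∈ S.seen, edgeOf φ q = e
  · obtain ⟨q, hq, rfl⟩ := h
    right
    rw [List.mem_toFinset, List.mem_map]
    exact ⟨q, List.mem_filter.2 ⟨hq, D.fits hi hj hq he⟩, rfl⟩
  · left
    refine ⟨h1, ?_⟩
    rw [List.mem_toFinset, List.mem_map]
    exact h

theorem card_seen_le (D : Depicts side β φ S X Y W) (i j : ℕ) :
    ((onSide side β X \ (S.seen.map (edgeOf φ)).toFinset) ∪
      ((S.seen.filter (S.fits i j)).map (edgeOf φ)).toFinset).card ≤ S.load i j := by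
  refine (Finset.card_union_le _ _).trans ?_
  refine Nat.add_le_add D.card_unseen_le ((List.toFinset_card_le _).trans ?_)
  simp

theorem card_compat_le (A : Arena B side n) (D : Depicts side β φ S X Y W)
    (r : Reach σ m X Y ℓ) {i j : ℕ} {u v : V} (hi : IsNumber φ S.size u i)
    (hj : IsNumber φ S.size v j) (hu : side u = β) (hv : side v = β) :
    (compat (Taken B Y) X u v).card ≤ S.load i j :=
  (Finset.card_le_card (D.subset_seen A r hi hj hu hv)).trans (D.card_seen_le i j)

/-- When `load` is attained, all unseen edges on this side and all fitting seen edges are usable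
with the spine; an edge left over must be seen and not fit. -/
theorem exists_not_fits (A : Arena B side n) (D : Depicts side β φ S X Y W)
    (r : Reach σ m X Y ℓ) {i j : ℕ} {u v : V} (hi : IsNumber φ S.size u i)
    (hj : IsNumber φ S.size v j) (hu : side u = β) (hv : side v = β)
    (hc : S.load i j ≤ (compat (Taken B Y) X u v).card) {t : Sym2 V} (ht : t ∈ onSide side β X)
    (htc : t ∉ compat (Taken B Y) X u v) : ∃ q ∈ S.seen, t = edgeOf φ q ∧ S.fits i j q = false := by
  by_contra! h
  have h1 : insert t (compat (Taken B Y) X u v) ⊆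
      (onSide side β X \ (S.seen.map (edgeOf φ)).toFinset) ∪
        ((S.seen.filter (S.fits i j)).map (edgeOf φ)).toFinset := by
    refine Finset.insert_subset ?_ (D.subset_seen A r hi hj hu hv)
    rw [Finset.mem_union, Finset.mem_sdiff, List.mem_toFinset, List.mem_map, List.mem_toFinset,
      List.mem_map]
    by_cases hq : ∃ q ∈ S.seen, edgeOf φ q = t
    · obtain ⟨q, hq, rfl⟩ := hq
      exact Or.inr ⟨q, List.mem_filter.2 ⟨hq, by simpa using h q hq rfl⟩, rfl⟩
    · exact Or.inl ⟨ht, hq⟩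
  have h2 := (Finset.card_le_card h1).trans (D.card_seen_le i j)
  rw [Finset.card_insert_of_notMem htc] at h2
  omega

theorem atMost_of_tame (A : Arena B side n) (D : Depicts side β φ S X Y W)
    (r : Reach σ m X Y ℓ) (ht : S.tame = true) (hX : X.card = S.own.length + 1) :
    AtMost B 8 X Y := by
  simp only [Diagram.tame, Bool.and_eq_true, Bool.or_eq_true, decide_eq_true_eq] at ht
  obtain ⟨h1, h2⟩ := ht
  rcases h2 with h2 | h2
  · intro u v E _ _
    exact (Finset.card_le_card Finset.inter_subset_left).trans (by omega)
  · refine atMost_of_spines A (D.card_away_le.trans (by omega)) (fun u v huv hu hv hf => ?_) r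
    obtain ⟨i, hi⟩ := exists_isNumber φ S.size u
    obtain ⟨j, hj⟩ := exists_isNumber φ S.size v
    have := D.forallFree h2 hi hj huv (notMem_taken.1 hf).2
    simp only [decide_eq_true_eq] at this
    exact (D.card_compat_le A r hi hj hu hv).trans (by omega)

end Depicts

end Building

end RamseyGame
namespace RamseyGame

/-! ### Leaves of the tree: a safe core defeats P1. -/

section Finishing

variable {V : Type*} [DecidableEq V] {B : SimpleGraph V} {σ : Strategy₁ B targetG} {m ℓ n : ℕ}
  {X Y : Finset (Sym2 V)} {side : V → Bool} {β : Bool} {φ : ℕ → V} {S : Diagram} {W : Finset V}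

/-- With seven of at most eleven edges on the side of `u`, at most four are in the other clique,
which gives `far`. -/
theorem answerable_of_compat (A : Arena B side n) (r : Reach σ m X Y ℓ) {u v : V} (huv : u ≠ v)
    (hs : side u = side v) (h7 : (compat (Taken B Y) X u v).card = 7) (hX : X.card ≤ 11)
    (h1 : (onSide side (side u) X \ compat (Taken B Y) X u v).card ≤ 1)
    (hstray : ∀ t ∈ onSide side (side u) X \ compat (Taken B Y) X u v, ∃ c d, t = s(c, d) ∧
      c ≠ u ∧ c ≠ v ∧ d ≠ u ∧ d ≠ v ∧ s(u, d) ∉ X ∧ s(v, d) ∉ X ∧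
      (s(u, d) ∈ Taken B Y ∨ s(v, d) ∈ Taken B Y)) :
    Answerable B side u v (onSide side (side u) X \ compat (Taken B Y) X u v) X Y where
  ne := huv
  side_eq := hs
  far := by
    have := card_onSide_add A r (side u)
    have := Finset.card_le_card (compat_subset_onSide A r hs)
    omega
  cover := by
    intro e he
    by_cases hc : e ∈ compat (Taken B Y) X u v
    · rw [mem_compat] at hc
      rcases hc.2 with rfl | ⟨x, -, -, (rfl | rfl), -, -⟩
      · exact Or.inl (Sym2.mem_mk_left _ _)
      · exact Or.inl (Sym2.mem_mk_left _ _)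
      · exact Or.inr (Or.inl (Sym2.mem_mk_left _ _))
    · rw [Finset.mem_sdiff, mem_onSide, mem_onSide]
      have hb := r.left_board e he
      induction e with | _ x y =>
      rw [mem_edgeSet, A.adj] at hb
      by_cases hx : side x = side u
      · right; right; right
        refine ⟨⟨he, fun w hw => ?_⟩, hc⟩
        rcases Sym2.mem_iff.1 hw with rfl | rfl <;> simp [← hb.2, hx]
      · right; right; left
        refine ⟨he, fun w hw => ?_⟩
        rcases Sym2.mem_iff.1 hw with rfl | rfl <;> simpa [← hb.2] using Bool.eq_not_of_ne hx
  stray_unique := h1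
  stray := hstray
  spine := Or.inr h7.le

namespace Depicts

theorem core (D : Depicts side β φ S X Y W) {a b c₁ c₂ c₃ : ℕ}
    (h : S.isCore a b c₁ c₂ c₃ = true) : ∃ C : Finset V, C.card = 3 ∧ φ a ≠ φ b ∧ φ a ∉ C ∧
      φ b ∉ C ∧ book (φ a) (φ b) C ⊆ Y ∧ a < S.size ∧ b < S.size := by
  simp only [Diagram.isCore, Bool.and_eq_true, bne_iff_ne] at h
  obtain ⟨⟨⟨⟨⟨⟨⟨⟨⟨hab, ha1⟩, ha2⟩, ha3⟩, hb1⟩, hb2⟩, hb3⟩, h12⟩, h13⟩, h23⟩ := h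
  have hab := D.mem_of_adj_lt hab
  have ha1 := D.mem_of_adj_lt ha1
  have ha2 := D.mem_of_adj_lt ha2
  have ha3 := D.mem_of_adj_lt ha3
  have hb1 := D.mem_of_adj_lt hb1
  have hb2 := D.mem_of_adj_lt hb2
  have hb3 := D.mem_of_adj_lt hb3
  have ne : ∀ {i j : ℕ}, i < S.size → j < S.size → i ≠ j → φ i ≠ φ j :=
    fun hi hj hij h => hij (D.inj _ hi _ hj h)
  refine ⟨{φ c₁, φ c₂, φ c₃}, ?_, ne hab.1 hab.2.1 hab.2.2.1, ?_, ?_, ?_, hab.1, hab.2.1⟩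
  · exact Finset.card_eq_three.2 ⟨_, _, _, ne ha1.2.1 ha2.2.1 h12, ne ha1.2.1 ha3.2.1 h13,
      ne ha2.2.1 ha3.2.1 h23, rfl⟩
  · simp [ne ha1.1 ha1.2.1 ha1.2.2.1, ne ha2.1 ha2.2.1 ha2.2.2.1, ne ha3.1 ha3.2.1 ha3.2.2.1]
  · simp [ne hb1.1 hb1.2.1 hb1.2.2.1, ne hb2.1 hb2.2.1 hb2.2.2.1, ne hb3.1 hb3.2.1 hb3.2.2.1]
  · intro e he
    rw [mem_book] at he
    rcases he with rfl | ⟨c, hc, rfl | rfl⟩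
    · exact hab.2.2.2
    all_goals
      simp only [Finset.mem_insert, Finset.mem_singleton] at hc
      rcases hc with rfl | rfl | rfl
    · exact ha1.2.2.2
    · exact ha2.2.2.2
    · exact ha3.2.2.2
    · exact hb1.2.2.2
    · exact hb2.2.2.2
    · exact hb3.2.2.2

/-- The only edge of the first player on the side of the diagram that does not fit a full spine
cannot be used against it. -/
theorem stray (A : Arena B side n) (D : Depicts side β φ S X Y W) (r : Reach σ m X Y ℓ)
    {i j : ℕ} {u v : V} (hi : IsNumber φ S.size u i) (hj : IsNumber φ S.size v j)
    (hu : side u = β) (hv : side v = β)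
    (hc : S.load i j ≤ (compat (Taken B Y) X u v).card)
    (h1 : (onSide side β X \ compat (Taken B Y) X u v).card ≤ 1)
    (hseen : ∀ e ∈ S.seen, S.fits i j e = true ∨ (e.1 ≠ i ∧ e.1 ≠ j ∧ e.2 ≠ i ∧ e.2 ≠ j ∧
      (S.blocked i j e.1 = true ∨ S.blocked i j e.2 = true)))
    {t : Sym2 V} (ht : t ∈ onSide side β X \ compat (Taken B Y) X u v) :
    ∃ c d, t = s(c, d) ∧ c ≠ u ∧ c ≠ v ∧ d ≠ u ∧ d ≠ v ∧ s(u, d) ∉ X ∧ s(v, d) ∉ X ∧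
      (s(u, d) ∈ Taken B Y ∨ s(v, d) ∈ Taken B Y) := by
  have ht' := Finset.mem_sdiff.1 ht
  obtain ⟨q, hq, rfl, hfit⟩ := D.exists_not_fits A r hi hj hu hv hc ht'.1 ht'.2
  obtain ⟨hq1, hq2⟩ := D.seen_lt q hq
  obtain ⟨n1, n2, n3, n4, hbl⟩ := (hseen q hq).resolve_left (by simp [hfit])
  have ne : ∀ {x y : ℕ} {w : V}, x < S.size → IsNumber φ S.size w y → x ≠ y → φ x ≠ w :=
    fun hx hn hne h => hne (D.isNumber hx hn h).symm
  have key : ∀ x y : ℕ, edgeOf φ q = s(φ x, φ y) → x < S.size → y < S.size → x ≠ i → x ≠ j →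
      y ≠ i → y ≠ j → S.blocked i j y = true → s(u, φ y) ∉ X ∧ s(v, φ y) ∉ X ∧
      (s(u, φ y) ∈ Taken B Y ∨ s(v, φ y) ∈ Taken B Y) := by
    intro x y hxy hx hy nxi nxj nyi nyj hb
    have hT : s(u, φ y) ∈ Taken B Y ∨ s(v, φ y) ∈ Taken B Y := by
      simp only [Diagram.blocked, Bool.or_eq_true] at hb
      exact hb.imp (fun h => Or.inr (D.mem_of_adj hi (Or.inl ⟨hy, rfl⟩) h))
        (fun h => Or.inr (D.mem_of_adj hj (Or.inl ⟨hy, rfl⟩) h))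
    -- Such an edge of P1 would end at a blocked vertex and so be a second edge outside `compat`.
    have hX : ∀ w : V, (w = u ∨ w = v) → side w = β → s(w, φ y) ∉ X := by
      intro w hw hwβ hwX
      have hws : s(w, φ y) ∈ onSide side β X := by
        rw [mem_onSide]
        refine ⟨hwX, fun z hz => ?_⟩
        rcases Sym2.mem_iff.1 hz with rfl | rfl
        · exact hwβ
        · exact D.side_eq _ hy
      have hwc : s(w, φ y) ∉ compat (Taken B Y) X u v := by
        have yu := ne hy hi nyi
        have yv := ne hy hj nyj
        rw [mem_compat]
        rintro ⟨-, h | ⟨x, xu, xv, h, hTu, hTv⟩⟩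
        · rw [Sym2.eq_iff] at h
          exact h.elim (fun h => yv h.2) (fun h => yu h.2)
        · have hxy : φ y = x := by
            rw [Sym2.eq_iff, Sym2.eq_iff] at h
            rcases h with (h | h) | (h | h)
            · exact h.2
            · exact absurd h.2 yu
            · exact h.2
            · exact absurd h.2 yv
          subst hxy
          exact hT.elim hTu hTv
      have := Finset.card_le_one.1 h1 _ ht _ (Finset.mem_sdiff.2 ⟨hws, hwc⟩)
      rw [hxy, Sym2.eq_iff] at this
      have := ne hx hi nxi
      have := ne hx hj nxj
      have := ne hy hi nyi
      have := ne hy hj nyj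
      grind
    exact ⟨hX u (Or.inl rfl) hu, hX v (Or.inr rfl) hv, hT⟩
  rcases hbl with hbl | hbl
  · exact ⟨φ q.2, φ q.1, Sym2.eq_swap, ne hq2 hi n3, ne hq2 hj n4, ne hq1 hi n1, ne hq1 hj n2,
      key q.2 q.1 Sym2.eq_swap hq2 hq1 n3 n4 n1 n2 hbl⟩
  · exact ⟨φ q.1, φ q.2, rfl, ne hq1 hi n1, ne hq1 hj n2, ne hq2 hi n3, ne hq2 hj n4,
      key q.1 q.2 rfl hq1 hq2 n1 n2 n3 n4 hbl⟩

/-- If P1 has at most seven edges on the core's side, a full book uses all of them; with eight, at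
most one is stray, and `nineSafe` controls it; with more, `safe` allows no spine with seven usable
edges. Thus either `answer_threats` or `no_threats` applies. -/
theorem false_of_safe (A : Arena B side n) (G : GuaranteesWinWithin σ m) (hm : m + 104 ≤ 2 * n)
    (D : Depicts side β φ S X Y W) (r : Reach σ m X Y ℓ) (hev : Even ℓ)
    (hX : X.card = S.own.length) (hlen : S.own.length ≤ 11) (hslack : S.slack ≤ 6)
    (hW : W.card ≤ 44) {a b c₁ c₂ c₃ : ℕ} (hcore : S.isCore a b c₁ c₂ c₃ = true)
    (hsafe : S.safe b = true) : False := by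
  obtain ⟨C, hC, hab, haC, hbC, hY, ha, hb⟩ := D.core hcore
  have hsum := card_onSide_add A r β
  have haway := D.card_away_le
  have haway' : 0 < (onSide side (!β) X).card := by
    obtain ⟨e, -, he⟩ := D.away
    exact Finset.card_pos.2 ⟨e, he⟩
  have answer : ∀ {u v : V} {T : Finset (Sym2 V)}, Answerable B side u v T X Y → False := by
    intro u v T h
    -- With `u` and `v` added there are at most 46 touched vertices, and `2 * 46 ≤ 100`.
    refine answer_threats A G (c₀ := 100) (by omega) hC hab haC hbC m X Y (insert u (insert v W)) ℓ
      (by omega) hev r hY h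
      (fun e he w hw => Finset.mem_insert_of_mem (Finset.mem_insert_of_mem (D.touched e he w hw)))
      (by simp) (by simp) ?_
    have := Finset.card_insert_le u (insert v W)
    have := Finset.card_insert_le v W
    omega
  have calm : AtMost B 6 X Y → ((onSide side β X).card ≤ 9 ∨ S.endSafe b = true) → False := by
    intro h6 h
    refine no_threats A G (c₀ := 100) (by omega) hC hab haC hbC hev r hY h6 D.touched
      (by omega) ?_
    refine h.imp (fun h => by rwa [D.side_eq _ ha]) fun h s hs => ?_
    have hs' := notMem_taken.1 hs
    have hadj := hs'.1
    rw [mem_edgeSet, A.adj, D.side_eq _ hb] at hadj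
    obtain ⟨j, hj⟩ := exists_isNumber φ S.size s
    have hbn : IsNumber φ S.size (φ b) b := Or.inl ⟨hb, rfl⟩
    refine (D.card_compat_le A r hbn hj (D.side_eq _ hb) hadj.2.symm).trans ?_
    simp only [Diagram.endSafe, List.all_eq_true, List.mem_range, Bool.or_eq_true, beq_iff_eq,
      decide_eq_true_eq] at h
    rcases h j (Nat.lt_succ_of_le hj.le) with (h | rfl) | h
    · exact absurd (D.mem_of_adj hbn hj h) hs'.2
    · rcases hj with hj | hj
      · exact absurd hj.2 hadj.1
      · omega
    · exact h
  by_cases h8 : (onSide side β X).card ≤ 7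
  · by_cases h6 : AtMost B 6 X Y
    · exact calm h6 (Or.inl (by omega))
    · simp only [AtMost, not_forall, not_le] at h6
      obtain ⟨u, v, E, _, hf, h7⟩ := h6
      have hs := (hf.same_side A).1
      have h1 := Finset.card_le_card (inter_book_subset_compat (X := X) hf)
      have h2 := Finset.card_le_card (compat_subset_onSide A r hs)
      have h3 : (onSide side (side u) X).card ≤ 7 := by
        by_cases hu : side u = β
        · rwa [hu]
        · rw [Bool.eq_not_of_ne hu]
          omega
      -- The seven edges of the full book are all of P1's edges on this side, so nothing is stray.
      have h4 : onSide side (side u) X \ compat (Taken B Y) X u v = ∅ := by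
        rw [Finset.sdiff_eq_empty_iff_subset,
          Finset.eq_of_subset_of_card_le (compat_subset_onSide A r hs) (by omega)]
      exact answer (answerable_of_compat A r hf.1 hs (by omega) (by omega) (by simp [h4])
        (by simp [h4]))
  · simp only [Diagram.safe, Bool.or_eq_true, Bool.and_eq_true, decide_eq_true_eq] at hsafe
    rcases hsafe with (h | ⟨h, hnine⟩) | ⟨h, hend⟩
    · omega
    · by_cases h6 : ∀ u v, u ≠ v → side u = β → side v = β → s(u, v) ∉ Taken B Y →
          (compat (Taken B Y) X u v).card ≤ 6
      · exact calm (atMost_of_spines (β := β) A (by omega) h6 r) (Or.inl (by omega))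
      · push Not at h6
        obtain ⟨u, v, huv, hu, hv, hf, h7⟩ := h6
        obtain ⟨i, hi⟩ := exists_isNumber φ S.size u
        obtain ⟨j, hj⟩ := exists_isNumber φ S.size v
        have hP := D.forallFree hnine hi hj huv (notMem_taken.1 hf).2
        have hle := D.card_compat_le A r hi hj hu hv
        simp only [Bool.or_eq_true, Bool.and_eq_true, decide_eq_true_eq, List.all_eq_true,
          bne_iff_ne, and_assoc] at hP
        obtain ⟨h7', hseen⟩ := hP.resolve_left (by omega)
        have hsub := compat_subset_onSide A r (hu.trans hv.symm)
        rw [hu] at hsub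
        have h1 : (onSide side β X \ compat (Taken B Y) X u v).card ≤ 1 := by
          rw [Finset.card_sdiff_of_subset hsub]
          omega
        refine answer (answerable_of_compat A r huv (hu.trans hv.symm) (by omega) (by omega)
          (by rwa [hu]) ?_)
        rw [hu]
        exact fun t ht => D.stray A r hi hj hu hv (by omega) h1 hseen ht
    · refine calm (atMost_of_spines (β := β) A (by omega) (fun u v huv hu hv hf => ?_) r)
        (hend.imp (fun h => by omega) id)
      obtain ⟨i, hi⟩ := exists_isNumber φ S.size u
      obtain ⟨j, hj⟩ := exists_isNumber φ S.size v
      have hP := D.forallFree h hi hj huv (notMem_taken.1 hf).2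
      simp only [decide_eq_true_eq] at hP
      exact (D.card_compat_le A r hi hj hu hv).trans hP

end Depicts

end Finishing

end RamseyGame
namespace RamseyGame

/-! ### Playing the tree against an arbitrary strategy of P1. -/

section Playing

variable {V : Type*} [DecidableEq V] {B : SimpleGraph V} {σ : Strategy₁ B targetG} {m ℓ n : ℕ}
  {X Y : Finset (Sym2 V)} {side : V → Bool} {β : Bool} {φ : ℕ → V} {S : Diagram} {W : Finset V}

namespace Depicts

theorem edgeOf_inj (D : Depicts side β φ S X Y W) {q q' : ℕ × ℕ} (h1 : q.1 < q.2)
    (h2 : q.2 < S.size) (h1' : q'.1 < q'.2) (h2' : q'.2 < S.size)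
    (h : edgeOf φ q = edgeOf φ q') : q = q' := by
  rw [edgeOf, edgeOf, Sym2.eq_iff] at h
  rcases h with ⟨a, b⟩ | ⟨a, b⟩
  · exact Prod.ext (D.inj _ (by omega) _ (by omega) a) (D.inj _ h2 _ h2' b)
  · have := D.inj _ (by omega) _ (by omega) a
    have := D.inj _ (by omega) _ (by omega) b
    omega

theorem edgeOf_mem (D : Depicts side β φ S X Y W) {q : ℕ × ℕ} (h1 : q.1 < S.size)
    (h2 : q.2 < S.size) : ∀ v ∈ edgeOf φ q, v ∈ W := by
  intro v hv
  rcases Sym2.mem_iff.1 hv with rfl | rfl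
  · exact D.mem _ h1
  · exact D.mem _ h2

theorem edgeOf_adj (A : Arena B side n) (D : Depicts side β φ S X Y W) {q : ℕ × ℕ}
    (h1 : q.1 < q.2) (h2 : q.2 < S.size) : edgeOf φ q ∈ B.edgeSet := by
  rw [edgeOf, mem_edgeSet, A.adj, D.side_eq _ (by omega), D.side_eq _ h2]
  exact ⟨fun h => h1.ne (D.inj _ (by omega) _ h2 h), rfl⟩

theorem claim (D : Depicts side β φ S X Y W) {q : ℕ × ℕ} (hq : q ∈ S.free) :
    Depicts side β φ (S.claim q) X (insert (edgeOf φ q) Y) W where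
  inj := D.inj
  side_eq := D.side_eq
  mem := D.mem
  own_lt := by
    obtain ⟨h1, h2, -, -⟩ := D.free q hq
    intro q' hq'
    rcases List.mem_cons.1 hq' with rfl | hq'
    · exact ⟨h1.trans h2, h2, h1.ne⟩
    · exact D.own_lt q' hq'
  own_iff := by
    intro e
    simp only [Diagram.claim, List.mem_cons, Finset.mem_insert, D.own_iff]
    grind
  seen_lt := D.seen_lt
  free := by
    obtain ⟨h1, h2, -, -⟩ := D.free q hq
    intro q' hq'
    simp only [Diagram.claim, List.mem_filter, bne_iff_ne] at hq'
    obtain ⟨h1', h2', h3', h4'⟩ := D.free q' hq'.1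
    refine ⟨h1', h2', h3', fun h => ?_⟩
    rcases Finset.mem_insert.1 h with h | h
    · exact hq'.2 (D.edgeOf_inj h1' h2' h1 h2 h)
    · exact h4' h
  slack := D.slack
  away := D.away
  touched := by
    obtain ⟨h1, h2, -, -⟩ := D.free q hq
    intro e he
    rw [Finset.mem_insert] at he
    rcases he with he | rfl | he
    · exact D.touched e (Or.inl he)
    · exact D.edgeOf_mem (h1.trans h2) h2
    · exact D.touched e (Or.inr he)

theorem see (D : Depicts side β φ S X Y W) {q : ℕ × ℕ} (hq : q ∈ S.free) :
    Depicts side β φ (S.see q) (insert (edgeOf φ q) X) Y W where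
  inj := D.inj
  side_eq := D.side_eq
  mem := D.mem
  own_lt := D.own_lt
  own_iff := D.own_iff
  seen_lt := by
    obtain ⟨h1, h2, -, -⟩ := D.free q hq
    intro q' hq'
    rcases List.mem_cons.1 hq' with rfl | hq'
    · exact ⟨h1.trans h2, h2⟩
    · exact D.seen_lt q' hq'
  free := by
    obtain ⟨h1, h2, -, -⟩ := D.free q hq
    intro q' hq'
    simp only [Diagram.see, List.mem_filter, bne_iff_ne] at hq'
    obtain ⟨h1', h2', h3', h4'⟩ := D.free q' hq'.1
    refine ⟨h1', h2', fun h => ?_, h4'⟩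
    rcases Finset.mem_insert.1 h with h | h
    · exact hq'.2 (D.edgeOf_inj h1' h2' h1 h2 h)
    · exact h3' h
  slack := by
    refine (Finset.card_le_card fun e he => ?_).trans D.slack
    simp only [Diagram.see, List.map_cons, List.toFinset_cons] at he
    grind
  away := by
    obtain ⟨e, he, he'⟩ := D.away
    refine ⟨e, Finset.mem_insert_of_mem he, ?_⟩
    rw [mem_onSide] at he' ⊢
    exact ⟨Finset.mem_insert_of_mem he, he'.2⟩
  touched := by
    obtain ⟨h1, h2, -, -⟩ := D.free q hq
    intro e he
    rw [Finset.mem_insert] at he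
    rcases he with (rfl | he) | he
    · exact D.edgeOf_mem (h1.trans h2) h2
    · exact D.touched e (Or.inl he)
    · exact D.touched e (Or.inr he)

theorem pass (D : Depicts side β φ S X Y W) {asked : List (ℕ × ℕ)} {e : Sym2 V}
    (h : ∀ q ∈ asked, q ∈ S.free ∧ e ≠ edgeOf φ q) :
    Depicts side β φ (S.pass asked) (insert e X) Y (W ∪ e.toFinset) where
  inj := D.inj
  side_eq := D.side_eq
  mem := fun i hi => Finset.mem_union_left _ (D.mem i hi)
  own_lt := D.own_lt
  own_iff := D.own_iff
  seen_lt := D.seen_lt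
  free := by
    intro q hq
    obtain ⟨h1, h2, h3, h4⟩ := D.free q (h q hq).1
    refine ⟨h1, h2, fun h' => ?_, h4⟩
    rcases Finset.mem_insert.1 h' with h' | h'
    · exact (h q hq).2 h'.symm
    · exact h3 h'
  slack := by
    have h1 : insert e X \ (S.seen.map (edgeOf φ)).toFinset ⊆
        insert e (X \ (S.seen.map (edgeOf φ)).toFinset) := by
      intro f hf
      simp only [Finset.mem_sdiff, Finset.mem_insert] at hf ⊢
      tauto
    have h2 := (Finset.card_le_card h1).trans (Finset.card_insert_le _ _)
    have := D.slack
    simp only [Diagram.pass]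
    omega
  away := by
    obtain ⟨e, he, he'⟩ := D.away
    refine ⟨e, Finset.mem_insert_of_mem he, ?_⟩
    rw [mem_onSide] at he' ⊢
    exact ⟨Finset.mem_insert_of_mem he, he'.2⟩
  touched := D.touched.insert_left e

theorem extend (D : Depicts side β φ S X Y W) {i : ℕ} (hi : i < S.size) {x : V} (hxW : x ∉ W)
    (hx : side x = β) : Depicts side β (Function.update φ S.size x) (S.extend i) X
      (insert s(φ i, x) Y) (insert x W) := by
  have old : ∀ j < S.size, Function.update φ S.size x j = φ j :=
    fun j hj => Function.update_of_ne hj.ne _ _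
  have edge : ∀ q : ℕ × ℕ, q.1 < S.size → q.2 < S.size →
      edgeOf (Function.update φ S.size x) q = edgeOf φ q := by
    intro q h1 h2
    rw [edgeOf, old _ h1, old _ h2, edgeOf]
  have ne : ∀ j < S.size, φ j ≠ x := fun j hj h => hxW (h ▸ D.mem j hj)
  have new : ∀ j < S.size, s(φ j, x) ∉ X ∧ s(φ j, x) ∉ Y := fun j hj =>
    ⟨fun h => hxW (D.touched _ (Or.inl h) x (Sym2.mem_mk_right _ _)),
      fun h => hxW (D.touched _ (Or.inr h) x (Sym2.mem_mk_right _ _))⟩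
  refine ⟨?_, ?_, ?_, ?_, ?_, ?_, ?_, ?_, D.away, ?_⟩
  · intro j hj k hk h
    simp only [Diagram.extend] at hj hk
    rcases Nat.lt_succ_iff_lt_or_eq.1 hj with hj | rfl <;>
      rcases Nat.lt_succ_iff_lt_or_eq.1 hk with hk | rfl
    · rw [old j hj, old k hk] at h
      exact D.inj j hj k hk h
    · rw [old j hj, Function.update_self] at h
      exact absurd h (ne j hj)
    · rw [old k hk, Function.update_self] at h
      exact absurd h.symm (ne k hk)
    · rfl
  · intro j hj
    rcases Nat.lt_succ_iff_lt_or_eq.1 hj with hj | rfl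
    · rw [old j hj, D.side_eq j hj]
    · rw [Function.update_self, hx]
  · intro j hj
    rcases Nat.lt_succ_iff_lt_or_eq.1 hj with hj | rfl
    · rw [old j hj]
      exact Finset.mem_insert_of_mem (D.mem j hj)
    · rw [Function.update_self]
      exact Finset.mem_insert_self _ _
  · intro q hq
    simp only [Diagram.extend, List.mem_cons] at hq ⊢
    rcases hq with rfl | hq
    · exact ⟨by omega, by omega, hi.ne⟩
    · have := D.own_lt q hq
      exact ⟨by omega, by omega, this.2.2⟩
  · intro e
    have h1 : edgeOf (Function.update φ S.size x) (i, S.size) = s(φ i, x) := by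
      simp only [edgeOf, old i hi, Function.update_self]
    simp only [Diagram.extend, List.mem_cons, Finset.mem_insert, D.own_iff, exists_eq_or_imp, h1]
    refine or_congr_right (exists_congr fun q => and_congr_right fun hq => ?_)
    rw [edge q (D.own_lt q hq).1 (D.own_lt q hq).2.1]
  · intro q hq
    have := D.seen_lt q hq
    simp only [Diagram.extend]
    omega
  · intro q hq
    simp only [Diagram.extend, List.mem_append, List.mem_map, List.mem_filter, List.mem_range,
      bne_iff_ne] at hq ⊢
    rcases hq with hq | ⟨j, ⟨hj, hji⟩, rfl⟩
    · obtain ⟨h1, h2, h3, h4⟩ := D.free q hq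
      rw [edge q (h1.trans h2) h2, Finset.mem_insert, not_or]
      refine ⟨h1, by omega, h3, fun h => ?_, h4⟩
      exact hxW (D.edgeOf_mem (h1.trans h2) h2 x (h ▸ Sym2.mem_mk_right _ _))
    · have h1 : edgeOf (Function.update φ S.size x) (j, S.size) = s(φ j, x) := by
        simp only [edgeOf, old j hj, Function.update_self]
      rw [h1, Finset.mem_insert, not_or]
      refine ⟨hj, by omega, (new j hj).1, fun h => ?_, (new j hj).2⟩
      rw [Sym2.eq_iff] at h
      rcases h with ⟨h, -⟩ | ⟨h, -⟩
      · exact hji (D.inj j hj i hi h)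
      · exact ne j hj h
  · have h1 : S.seen.map (edgeOf (Function.update φ S.size x)) = S.seen.map (edgeOf φ) :=
      List.map_congr_left fun q hq => edge q (D.seen_lt q hq).1 (D.seen_lt q hq).2
    simp only [Diagram.extend, h1]
    exact D.slack
  · intro e he v hv
    rw [Finset.mem_insert] at he
    rcases he with he | rfl | he
    · exact Finset.mem_insert_of_mem (D.touched e (Or.inl he) v hv)
    · rcases Sym2.mem_iff.1 hv with rfl | rfl
      · exact Finset.mem_insert_of_mem (D.mem i hi)
      · exact Finset.mem_insert_self _ _
    · exact Finset.mem_insert_of_mem (D.touched e (Or.inr he) v hv)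

end Depicts

/-- A valid plan defeats every strategy of the first player that wins in time. -/
theorem Plan.false_of_valid (A : Arena B side n) (G : GuaranteesWinWithin σ m)
    (hm : m + 104 ≤ 2 * n) (P : Plan) : ∀ S : Diagram,
    (P.valid S none = true → ∀ X Y W φ, Depicts side β φ S X Y W →
      Reach σ m X Y (2 * S.own.length + 1) → X.card = S.own.length + 1 →
      W.card ≤ 4 * S.own.length + 2 → False) ∧
    ∀ asked, P.valid S (some asked) = true → ∀ X Y W φ e, Depicts side β φ S X Y W → e ∉ X →
      Reach σ m (insert e X) Y (2 * S.own.length + 1) → X.card = S.own.length →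
      W.card ≤ 4 * S.own.length → (∀ q ∈ asked, q ∈ S.free ∧ e ≠ edgeOf φ q) → False := by
  induction P with
  | finish i j a b c₁ c₂ c₃ =>
    refine fun S => ⟨fun h X Y W φ D r hX hW => ?_, fun asked h => by simp [Plan.valid] at h⟩
    simp only [Plan.valid, Bool.and_eq_true, decide_eq_true_eq, List.contains_iff_mem] at h
    obtain ⟨⟨⟨⟨htame, hlen⟩, hfree⟩, hcore⟩, hsafe⟩ := h
    have hno := (D.atMost_of_tame A r htame hX).noCopy r
    obtain ⟨h1, h2, h3, h4⟩ := D.free _ hfree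
    have r' := r.step_two G hno ⟨_, rfl⟩ (D.edgeOf_adj A h1 h2) h3 h4
    simp only [Diagram.tame, Bool.and_eq_true, decide_eq_true_eq] at htame
    exact (D.claim hfree).false_of_safe A G hm r' ⟨S.own.length + 1, by omega⟩
      (by simpa [Diagram.claim] using hX) (Nat.succ_le_succ hlen) htame.1 (by omega)
      hcore hsafe
  | move i j next ih =>
    refine fun S => ⟨fun h X Y W φ D r hX hW => ?_, fun asked h => by simp [Plan.valid] at h⟩
    simp only [Plan.valid, Bool.and_eq_true, Bool.or_eq_true, decide_eq_true_eq, beq_iff_eq,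
      List.contains_iff_mem] at h
    obtain ⟨⟨htame, hlen⟩, h⟩ := h
    have hno := (D.atMost_of_tame A r htame hX).noCopy r
    have hodd : Odd (2 * S.own.length + 1) := ⟨_, rfl⟩
    have hev : Even (2 * S.own.length + 1 + 1) := ⟨S.own.length + 1, by omega⟩
    rcases h with ⟨⟨hi, -⟩, h⟩ | ⟨hfree, h⟩
    · obtain ⟨x, hxW, hx⟩ := A.fresh β W (by omega)
      have hB : s(φ i, x) ∈ B.edgeSet := by
        rw [mem_edgeSet, A.adj, D.side_eq i hi, hx]
        exact ⟨fun h => hxW (h ▸ D.mem i hi), rfl⟩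
      have r' := r.step_two G hno hodd hB
        (fun h => hxW (D.touched _ (Or.inl h) x (Sym2.mem_mk_right _ _)))
        (fun h => hxW (D.touched _ (Or.inr h) x (Sym2.mem_mk_right _ _)))
      obtain ⟨e, -, heX, -, r''⟩ := r'.step_one G hno hev
      have hcard := Finset.card_insert_le x W
      refine (ih (S.extend i)).2 [] h X _ _ _ e (D.extend hi hxW hx) heX ?_ ?_ ?_ (by simp)
      · simpa [Diagram.extend, mul_add] using r''
      · simpa [Diagram.extend] using hX
      · simp only [Diagram.extend, List.length_cons]
        omega
    · obtain ⟨h1, h2, h3, h4⟩ := D.free _ hfree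
      have r' := r.step_two G hno hodd (D.edgeOf_adj A h1 h2) h3 h4
      obtain ⟨e, -, heX, -, r''⟩ := r'.step_one G hno hev
      refine (ih (S.claim (i, j))).2 [] h X _ _ _ e (D.claim hfree) heX ?_ ?_ ?_ (by simp)
      · simpa [Diagram.claim, mul_add] using r''
      · simpa [Diagram.claim] using hX
      · simp only [Diagram.claim, List.length_cons]
        omega
  | ask x y hit miss ih_hit ih_miss =>
    refine fun S => ⟨fun h => by simp [Plan.valid] at h, fun asked h X Y W φ e D he r hX hW ha => ?_⟩
    simp only [Plan.valid, Bool.and_eq_true, List.contains_iff_mem] at h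
    obtain ⟨⟨hfree, hhit⟩, hmiss⟩ := h
    -- During the inspection the diagram depicts the position without `e`. A hit adds `e` to `seen`;
    -- a miss only lengthens `asked`.
    by_cases hxy : e = edgeOf φ (x, y)
    · subst hxy
      refine (ih_hit (S.see (x, y))).1 hhit _ Y W φ (D.see hfree) r ?_ (hW.trans (by simp [Diagram.see]))
      rw [Finset.card_insert_of_notMem he, hX]
      rfl
    · refine (ih_miss S).2 _ hmiss X Y W φ e D he r hX hW fun q hq => ?_
      rcases List.mem_cons.1 hq with rfl | hq
      · exact ⟨hfree, hxy⟩
      · exact ha q hq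
  | other next ih =>
    refine fun S => ⟨fun h => by simp [Plan.valid] at h, fun asked h X Y W φ e D he r hX hW ha => ?_⟩
    refine (ih (S.pass asked)).1 h _ Y _ φ (D.pass ha) r ?_ ?_
    · rw [Finset.card_insert_of_notMem he, hX]
      rfl
    · have := card_union_toFinset_le W e
      simp only [Diagram.pass]
      omega

theorem noCopy_of_card_le (h : X.card ≤ 8) : NoCopy X := by
  intro u v C hC huv hu hv hsub
  have := Finset.card_le_card hsub
  rw [card_book huv hu hv, hC] at this
  omega

theorem not_guaranteesWinWithin (A : Arena B side n) (hm : m + 104 ≤ 2 * n) :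
    ¬ GuaranteesWinWithin σ m := by
  intro G
  obtain ⟨e, heB, -, -, r₁⟩ := (reach_nil (σ := σ) (m := m)).step_one G
    (noCopy_of_card_le (by simp)) Even.zero
  induction e with | _ x y =>
  -- P2 opens in the clique that P1 did not choose; P1's first edge then witnesses `away`
  -- throughout.
  obtain ⟨v, hvW, hv⟩ := A.fresh (!side x) {x, y} (by have := Finset.card_le_two (a := x) (b := y); omega)
  obtain ⟨w, hwW, hw⟩ := A.fresh (!side x) {x, y, v} (by
    have := Finset.card_le_three (a := x) (b := y) (c := v); omega)
  simp only [Finset.mem_insert, Finset.mem_singleton, not_or] at hvW hwW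
  have hno : NoCopy (insert s(x, y) ∅) := 
    noCopy_of_card_le ((Finset.card_insert_le _ _).trans (by rw [Finset.card_empty]; omega))
  have r₂ := r₁.step_two G hno (by decide) (e := s(v, w))
    (by rw [mem_edgeSet, A.adj, hv, hw]; exact ⟨Ne.symm hwW.2.2, rfl⟩)
    (by
      simp only [insert_empty_eq, Finset.mem_singleton, Sym2.eq_iff]
      rintro (⟨h, -⟩ | ⟨h, -⟩)
      · exact hvW.1 h
      · exact hvW.2 h)
    (by simp)
  obtain ⟨e, -, heX, -, r₃⟩ := r₂.step_one G hno (by decide)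
  rw [mem_edgeSet, A.adj] at heB
  have D : Depicts side (!side x) (fun i => if i = 0 then v else w) coreDiagram
      (insert s(x, y) ∅) (insert s(v, w) ∅) {x, y, v, w} := by
    refine ⟨?_, ?_, ?_, ?_, ?_, ?_, ?_, ?_, ?_, ?_⟩
    · intro i hi j hj h
      simp only [coreDiagram] at hi hj
      have := hwW.2.2
      interval_cases i <;> interval_cases j <;> simp_all
    · intro i _
      split_ifs
      · exact hv
      · exact hw
    · intro i _
      split_ifs <;> simp
    · simp [coreDiagram]
    · simp [coreDiagram, edgeOf]
    · simp [coreDiagram]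
    · simp [coreDiagram]
    · simp [coreDiagram]
    · refine ⟨s(x, y), by simp, ?_⟩
      rw [mem_onSide]
      refine ⟨by simp, fun z hz => ?_⟩
      rcases Sym2.mem_iff.1 hz with rfl | rfl <;> simp [heB.2]
    · intro e he z hz
      simp only [insert_empty_eq, Finset.mem_singleton] at he
      rcases he with rfl | rfl <;> rcases Sym2.mem_iff.1 hz with rfl | rfl <;> simp
  refine (Plan.false_of_valid A G hm Plan.corePlan coreDiagram).2 [] corePlan_valid _ _ _ _ e D heX
    r₃ (by simp [coreDiagram]) ?_ (by simp)
  exact Finset.card_le_four.trans (by simp [coreDiagram])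

end Playing

theorem arena_twoCliques (n : ℕ) : Arena (twoCliques n) Sum.isLeft n where
  adj := by
    rintro (x | x) (y | y) <;> simp [twoCliques]
  fresh := by
    intro b T hT
    by_contra! h
    have key : ∀ f : Fin n → Fin n ⊕ Fin n, Function.Injective f → (∀ i, (f i).isLeft = b) →
        False := by
      intro f hf hb
      have h1 : Finset.univ.image f ⊆ T := by
        intro x hx
        obtain ⟨i, -, rfl⟩ := Finset.mem_image.1 hx
        by_contra hx
        exact h _ hx (hb i)
      have := Finset.card_le_card h1
      rw [Finset.card_image_of_injective _ hf, Finset.card_univ, Fintype.card_fin] at this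
      omega
    cases b
    · exact key Sum.inr Sum.inr_injective fun _ => rfl
    · exact key Sum.inl Sum.inl_injective fun _ => rfl

end RamseyGame

theorem mainTheorem3 :
    ∃ C : ℕ, ∀ n m : ℕ, (m : ℤ) < 2 * (n : ℤ) - (C : ℤ) →
      ¬ ∃ σ : RamseyGame.Strategy₁ (RamseyGame.twoCliques n) RamseyGame.targetG,
        RamseyGame.GuaranteesWinWithin σ m := by
  -- Here 100 covers the vertices touched before the forcing phase, and 4 covers twice the two
  -- endpoints of P1's last free move before the endless threats.
  refine ⟨104, fun n m h => ?_⟩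
  rintro ⟨σ, G⟩
  exact RamseyGame.not_guaranteesWinWithin (RamseyGame.arena_twoCliques n) (by omega) G
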